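/- \textbf{Definitions.} A slope is an element of $\mathbb{Q}\cup\{\infty\}$; put $\pi_r(x,y)=x+ry$ for $r\in\mathbb{Q}$ and $\pi_\infty(x,y)=y$. For a random variable $Z$ taking finitely many values let $\mathbf{H}[Z]=\sum_z \mathbf{h}(\mathbf{P}(Z=z))$, where $\mathbf{h}(t)=t\log\frac1t$, $\mathbf{h}(0)=0$, and $\log$ is the natural logarithm. For a finite set $R$ of slopes and a slope $s\notin R$, let $\mathrm{SD}(R;s)\in(-\infty,+\infty]$ be the least exponent such that $$\mathbf{H}[\pi_s(X,Y)]\le \mathrm{SD}(R;s)\,\max_{r\in R}\mathbf{H}[\pi_r(X,Y)]$$ for all (not necessarily independent) $\mathbb{Q}$-valued random variables $X,Y$ taking finitely many values. For a smooth, compactly supported $f:\mathbb{R}^2\to[0,\infty)$ with $\int_{\mathbb{R}^2}f=1$ and for $\alpha\in\mathbb{R}$, define the folded density $f_{(\alpha)}(x,y)=\sum_{j\in\mathbb{Z}}f(x-\alpha j,y+j)$ on $\mathbb{R}\times[0,1)$ and the projected densities $$f_0(x)=\int_{\mathbb{R}}f(x,y)\,dy,\qquad f_\infty(y)=\int_{\mathbb{R}}f(x,y)\,dx,\qquad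 f_1(z)=\int_{\mathbb{R}}f(x,z-x)\,dx,$$ and the differential entropies $$h_2(f_{(\alpha)})=\int_0^1\int_{\mathbb{R}}\mathbf{h}(f_{(\alpha)}(x,y))\,dx\,dy,\qquad h(f_r)=\int_{\mathbb{R}}\mathbf{h}(f_r(x))\,dx\quad(r=0,1,\infty).$$ Let $c_\alpha$ be the infimum, over all such $f$, of $$2\max\bigl(h(f_0),h(f_\infty),h(f_1)\bigr)-h_2(f_{(\alpha)}).$$ \textbf{Theorem (Continuous limit).} For every $\alpha\in\mathbb{R}$ one has $0<c_\alpha<\infty$, and for coprime integers $a,b$ with $b\to+\infty$ and $a/b\to\alpha$, $$\mathrm{SD}\Bigl(\{0,1,\infty\};\frac ab\Bigr)\ \ge\ 2-\frac{c_\alpha+o(1)}{\log b}.$$ Explicitly: for every $\varepsilon>0$ there are $\delta>0$ and $N$ such that $\mathrm{SD}(\{0,1,\infty\};a/b)\ge 2-\frac{c_\alpha+\varepsilon}{\log b}$ for all coprime integers $a,b$ with $b\ge N$ and $|a/b-\alpha|<\delta$. -/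

import Mathlib

open MeasureTheory
open scoped ContDiff

noncomputable section

namespace SumDifference

/-- A slope: an element of the projective rational line `ℚ ∪ {∞}`. -/
abbrev Slope := OnePoint ℚ

/-- The projection `π_r`: `π_r(x,y) = x + r y` for rational `r`, and `π_∞(x,y) = y`. -/
def proj (r : Slope) (x y : ℚ) : ℚ :=
  r.elim y (fun t : ℚ => x + t * y)

theorem proj_infty (x y : ℚ) : proj OnePoint.infty x y = y := rfl

theorem proj_coe (t x y : ℚ) : proj (t : Slope) x y = x + t * y := rfl

/-- Shannon entropy `H[Z] = ∑_q h(P(Z = q))` of a `ℚ`-valued random variable (natural logarithm),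
where `h(t) = t log (1/t)`, `h(0) = 0`, is `Real.negMulLog`. It is only used for random variables
with finitely many values, for which the sum is finite. -/
def entropy {Ω : Type} [MeasurableSpace Ω] (μ : Measure Ω) (Z : Ω → ℚ) : ℝ :=
  ∑' q : ℚ, Real.negMulLog (μ.real (Z ⁻¹' {q}))

/-- `c` is an admissible exponent for `(R; s)`:
`H[π_s(X,Y)] ≤ c * max_{r ∈ R} H[π_r(X,Y)]` for all (jointly defined, possibly dependent)
`ℚ`-valued random variables `X, Y` taking finitely many values. -/
def IsExponent (R : Finset Slope) (s : Slope) (c : ℝ) : Prop :=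
  ∀ (Ω : Type) [MeasurableSpace Ω] (μ : Measure Ω) [IsProbabilityMeasure μ] (X Y : Ω → ℚ),
    Measurable X → Measurable Y → (Set.range X).Finite → (Set.range Y).Finite →
      entropy μ (fun u => proj s (X u) (Y u)) ≤
        c * ⨆ r : R, entropy μ (fun u => proj r.1 (X u) (Y u))

/-- The sum-difference constant `SD(R; s)`: the least admissible exponent
(`+∞` if there is none). -/
def SD (R : Finset Slope) (s : Slope) : EReal :=
  sInf ((fun c : ℝ => (c : EReal)) '' {c : ℝ | IsExponent R s c})

open Classical in
/-- The set of slopes `{0, 1, ∞}`. -/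
def threeSlopes : Finset Slope :=
  {((0 : ℚ) : Slope), ((1 : ℚ) : Slope), OnePoint.infty}

/-- Smooth compactly supported probability densities on `ℝ²`. -/
structure IsTestDensity (f : ℝ × ℝ → ℝ) : Prop where
  smooth : ContDiff ℝ ∞ f
  compactSupport : HasCompactSupport f
  nonneg : ∀ p, 0 ≤ f p
  mass_one : ∫ p, f p = 1

/-- The folded density `f_(α)(x,y) = ∑_{j ∈ ℤ} f(x - α j, y + j)`, used for `0 ≤ y < 1`. -/
def folded (α : ℝ) (f : ℝ × ℝ → ℝ) (x y : ℝ) : ℝ :=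
  ∑' j : ℤ, f (x - α * j, y + j)

/-- `f_0(x) = ∫ f(x,y) dy`. -/
def density0 (f : ℝ × ℝ → ℝ) (x : ℝ) : ℝ := ∫ y, f (x, y)

/-- `f_∞(y) = ∫ f(x,y) dx`. -/
def densityInf (f : ℝ × ℝ → ℝ) (y : ℝ) : ℝ := ∫ x, f (x, y)

/-- `f_1(z) = ∫ f(x,z-x) dx`. -/
def density1 (f : ℝ × ℝ → ℝ) (z : ℝ) : ℝ := ∫ x, f (x, z - x)

/-- One-dimensional differential entropy. -/
def diffEntropy (g : ℝ → ℝ) : ℝ := ∫ x, Real.negMulLog (g x)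

/-- Two-dimensional differential entropy on the strip `ℝ × [0,1)`. -/
def stripEntropy (g : ℝ → ℝ → ℝ) : ℝ :=
  ∫ y in Set.Ico (0 : ℝ) 1, ∫ x, Real.negMulLog (g x y)

/-- The functional whose infimum over test densities is `c_α`:
`2 max(h(f_0), h(f_∞), h(f_1)) - h₂(f_(α))`. -/
def functional (α : ℝ) (f : ℝ × ℝ → ℝ) : ℝ :=
  2 * max (diffEntropy (density0 f)) (max (diffEntropy (densityInf f)) (diffEntropy (density1 f)))
    - stripEntropy (folded α f)

end SumDifference

end

noncomputable section

namespace SumDifference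

open Filter Topology

/-! Lower bound on the exponent: sample a density `f` on the lattice of mesh `1/b` and normalise,
giving integer variables `X, Y`. The projections of slope 0, 1, ∞ have entropy `log b + h(f_r) +
o(1)`. As `a, b` are coprime, two lattice points have the same value of `x + (a/b) y` exactly when
they differ by a multiple of `(a, -b)`. After scaling this identification is the folding of slope
`a/b`, so that projection has entropy `2 log b + h₂(f_(α)) + o(1)`. Comparing the two gives `2 -
(functional α f + o(1)) / log b`, and `f` is then taken near the infimum. The asymptotics are
Riemann sums (`tendsto_riemann`, `tendsto_rowEntropy`, `tendsto_foldEntropy`).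

Positivity: folding cannot increase entropy (`stripEntropy_folded_le`), so it suffices to bound the
joint entropy strictly below twice the largest projected entropy, uniformly in `f`. Equality would
make `X, Y, X + Y` pairwise independent. The signs of `X - m`, `Y - n`, `X + Y - m - n`, with `m, n`
medians, satisfy a linear relation between their pairwise products (`side_identity`), so some pair
is correlated. The variational bound on mutual information turns this into the gap `1/20`
(`joint_entropy_le`). -/

/-- Continuous compactly supported probability densities on `ℝ²`. -/
structure IsDensity (f : ℝ × ℝ → ℝ) : Prop where
  cont : Continuous f
  supp : HasCompactSupport f
  nonneg : ∀ p, 0 ≤ f p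
  mass : ∫ p, f p = 1

theorem IsTestDensity.isDensity {f : ℝ × ℝ → ℝ} (hf : IsTestDensity f) : IsDensity f :=
  ⟨hf.smooth.continuous, hf.compactSupport, hf.nonneg, hf.mass_one⟩

/-! ### Planar densities and their marginals -/

namespace IsDensity

variable {f : ℝ × ℝ → ℝ}

theorem swap (hf : IsDensity f) : IsDensity (fun p => f p.swap) where
  cont := hf.cont.comp continuous_swap
  supp := hf.supp.comp_homeomorph (Homeomorph.prodComm ℝ ℝ)
  nonneg p := hf.nonneg _
  mass := by
    rw [← hf.mass]
    exact (Measure.measurePreserving_swap (μ := (volume : Measure ℝ))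
      (ν := (volume : Measure ℝ))).integral_comp' (f := MeasurableEquiv.prodComm) f

/-- The homeomorphism `(z, x) ↦ (x, z - x)`. -/
def shearHomeomorph : ℝ × ℝ ≃ₜ ℝ × ℝ where
  toFun p := (p.2, p.1 - p.2)
  invFun p := (p.1 + p.2, p.1)
  left_inv p := by ext <;> simp
  right_inv p := by ext <;> simp
  continuous_toFun := by fun_prop
  continuous_invFun := by fun_prop

theorem integral_shear (G : ℝ × ℝ → ℝ) :
    ∫ p : ℝ × ℝ, G (p.2, p.1 - p.2) = ∫ p, G p :=
  (measurePreserving_prod_sub_swap (volume : Measure ℝ) (volume : Measure ℝ)).integral_comp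
    shearHomeomorph.measurableEmbedding G

theorem integral_swap (G : ℝ × ℝ → ℝ) : ∫ p : ℝ × ℝ, G p.swap = ∫ p, G p :=
  (Measure.measurePreserving_swap (μ := (volume : Measure ℝ))
      (ν := (volume : Measure ℝ))).integral_comp' (f := MeasurableEquiv.prodComm) G

/-- This is the joint density of `(X + Y, X)`. With `swap` it reduces every fact about the three
projections to one about `density0`. -/
theorem shear (hf : IsDensity f) : IsDensity (fun p => f (p.2, p.1 - p.2)) where
  cont := hf.cont.comp (by fun_prop)
  supp := hf.supp.comp_homeomorph shearHomeomorph
  nonneg p := hf.nonneg _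
  mass := by rw [integral_shear, hf.mass]

theorem exists_box (hf : IsDensity f) :
    ∃ K : ℕ, ∀ x y, f (x, y) ≠ 0 → |x| ≤ K ∧ |y| ≤ K := by
  obtain ⟨R, hR⟩ := hf.supp.isBounded.exists_norm_le
  obtain ⟨K, hK⟩ := exists_nat_ge R
  refine ⟨K, fun x y h => ?_⟩
  have := (hR (x, y) (subset_tsupport f h)).trans hK
  rw [Prod.norm_def, max_le_iff] at this
  simpa using this

theorem exists_bound (hf : IsDensity f) : ∃ C : ℝ, 0 ≤ C ∧ ∀ p, f p ≤ C := by
  obtain ⟨C, hC⟩ := hf.cont.bounded_above_of_compact_support hf.supp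
  exact ⟨C, (norm_nonneg _).trans (hC 0), fun p => (le_abs_self _).trans (hC p)⟩

theorem density0_eq_setIntegral {K : ℝ} (hK : ∀ x y, f (x, y) ≠ 0 → |x| ≤ K ∧ |y| ≤ K) (x : ℝ) :
    density0 f x = ∫ y in Set.Icc (-K) K, f (x, y) := by
  refine (setIntegral_eq_integral_of_forall_compl_eq_zero fun y hy => ?_).symm
  by_contra h
  exact hy (abs_le.mp (hK x y h).2)

theorem continuous_density0 (hf : IsDensity f) : Continuous (density0 f) := by
  obtain ⟨K, hK⟩ := hf.exists_box
  rw [funext (density0_eq_setIntegral hK)]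
  exact continuous_parametric_integral_of_continuous (f := fun x y => f (x, y))
    (by simpa [Function.uncurry_def] using hf.cont) isCompact_Icc

theorem density0_eq_zero {K : ℝ} (hK : ∀ x y, f (x, y) ≠ 0 → |x| ≤ K ∧ |y| ≤ K) {x : ℝ}
    (hx : ¬ |x| ≤ K) : density0 f x = 0 := by
  have : ∀ y, f (x, y) = 0 := fun y => by
    by_contra h
    exact hx (hK x y h).1
  simp [density0, this]

theorem hasCompactSupport_density0 (hf : IsDensity f) : HasCompactSupport (density0 f) := by
  obtain ⟨K, hK⟩ := hf.exists_box
  refine HasCompactSupport.intro (isCompact_Icc (a := -(K : ℝ)) (b := K)) fun x hx => ?_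
  exact density0_eq_zero hK fun h => hx (abs_le.mp h)

theorem integrable (hf : IsDensity f) : Integrable f :=
  hf.cont.integrable_of_hasCompactSupport hf.supp

theorem density0_nonneg (hf : IsDensity f) (x : ℝ) : 0 ≤ density0 f x :=
  integral_nonneg fun _ => hf.nonneg _

theorem integral_density0 (hf : IsDensity f) : ∫ x, density0 f x = 1 := by
  rw [← hf.mass]
  exact (integral_prod f hf.integrable).symm

theorem integrable_density0 (hf : IsDensity f) : Integrable (density0 f) :=
  hf.continuous_density0.integrable_of_hasCompactSupport hf.hasCompactSupport_density0

theorem integrable_section (hf : IsDensity f) (x : ℝ) : Integrable fun y => f (x, y) := by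
  obtain ⟨K, hK⟩ := hf.exists_box
  refine Continuous.integrable_of_hasCompactSupport (hf.cont.comp (by fun_prop)) ?_
  refine HasCompactSupport.intro (isCompact_Icc (a := -(K : ℝ)) (b := K)) fun y hy => ?_
  by_contra h
  exact hy (abs_le.mp (hK x y h).2)

/-- Continuity gives positivity at every point rather than almost everywhere, so the Gibbs
inequality can be used pointwise. -/
theorem density0_pos (hf : IsDensity f) {x y : ℝ} (h : f (x, y) ≠ 0) : 0 < density0 f x :=
  (hf.cont.comp (by fun_prop : Continuous fun y : ℝ => (x, y))).integral_pos_of_hasCompactSupport_nonneg_nonzero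
    (by
      obtain ⟨K, hK⟩ := hf.exists_box
      refine HasCompactSupport.intro (isCompact_Icc (a := -(K : ℝ)) (b := K)) fun y hy => ?_
      by_contra h
      exact hy (abs_le.mp (hK x y h).2)) (fun y => hf.nonneg _) h

theorem integrable_mul_fst (hf : IsDensity f) {g : ℝ → ℝ} (hg : Measurable g)
    (h : Integrable fun x => density0 f x * g x) : Integrable fun p : ℝ × ℝ => f p * g p.1 := by
  have hm : AEStronglyMeasurable (fun p : ℝ × ℝ => f p * g p.1) (volume.prod volume) :=
    hf.cont.aestronglyMeasurable.mul (hg.comp measurable_fst).aestronglyMeasurable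
  refine (integrable_prod_iff hm).mpr
    ⟨.of_forall fun x => (hf.integrable_section x).mul_const (g x), ?_⟩
  have : (fun x => ∫ y, ‖f (x, y) * g x‖) = fun x => ‖density0 f x * g x‖ := by
    funext x
    simp_rw [norm_mul, Real.norm_of_nonneg (hf.nonneg _), Real.norm_of_nonneg (hf.density0_nonneg _)]
    exact integral_mul_const _ _
  simp only [this]
  exact h.norm

theorem integral_mul_fst (hf : IsDensity f) {g : ℝ → ℝ} (hg : Measurable g)
    (h : Integrable fun x => density0 f x * g x) :
    ∫ p : ℝ × ℝ, f p * g p.1 = ∫ x, density0 f x * g x := by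
  rw [Measure.volume_eq_prod, integral_prod _ (hf.integrable_mul_fst hg h)]
  exact integral_congr_ae (.of_forall fun x => integral_mul_const (g x) fun y => f (x, y))

theorem density0_swap : density0 (fun p => f p.swap) = densityInf f := rfl

theorem density0_shear : density0 (fun p => f (p.2, p.1 - p.2)) = density1 f := rfl

theorem densityInf_shear : densityInf (fun p => f (p.2, p.1 - p.2)) = density0 f := by
  funext x
  exact integral_sub_right_eq_self (fun z => f (x, z)) x

theorem density1_swap : density1 (fun p => f p.swap) = density1 f := by
  funext z
  have := integral_sub_left_eq_self (fun x => f (x, z - x)) volume z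
  simpa [density1] using this

/-! ### Medians and signs -/

/-- The sign of `x - m`, equal to `-1` at `m`. -/
def side (m x : ℝ) : ℝ := if x ≤ m then -1 else 1

theorem measurable_side (m : ℝ) : Measurable (side m) :=
  Measurable.ite measurableSet_Iic measurable_const measurable_const

theorem side_eq (m x : ℝ) : side m x = -1 ∨ side m x = 1 := by
  unfold side; split_ifs <;> simp

/-- If the signs of `x - m` and `y - n` agree, the sum has that sign too and the value is `1 + 1 -
1`. If they differ, the first two products cancel and the third contributes `1`. -/
theorem side_identity (m n x y : ℝ) :
    side (m + n) (x + y) * side m x + side (m + n) (x + y) * side n y - side m x * side n y = 1 := by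
  unfold side
  split_ifs <;> first | (exfalso; linarith) | norm_num

/-- A density on the line has a median. -/
theorem exists_median (hf : IsDensity f) : ∃ m, ∫ x, density0 f x * side m x = 0 := by
  obtain ⟨K, hK⟩ := hf.exists_box
  have hint := hf.integrable_density0
  have key : ∀ m, ∫ x, density0 f x * side m x = 1 - 2 * ∫ x in Set.Iic m, density0 f x := by
    intro m
    have e : (fun x => density0 f x * side m x) =
        fun x => density0 f x - 2 * (Set.Iic m).indicator (density0 f) x := by
      funext x
      by_cases h : x ≤ m
      · simp [side, Set.indicator, h]; ring
      · simp [side, Set.indicator, h]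
    rw [e, integral_sub hint ((hint.indicator measurableSet_Iic).const_mul 2), integral_const_mul,
      integral_indicator measurableSet_Iic, hf.integral_density0]
  have hc : Continuous fun m => ∫ x in Set.Iic m, density0 f x := by
    have : (fun m => ∫ x in Set.Iic m, density0 f x) =
        fun m => (∫ x in Set.Iic 0, density0 f x) + ∫ x in (0 : ℝ)..m, density0 f x := by
      funext m
      rw [← intervalIntegral.integral_Iic_sub_Iic hint.integrableOn hint.integrableOn]
      ring
    rw [this]
    exact continuous_const.add (intervalIntegral.continuous_primitive
      (fun a b => hint.intervalIntegrable) 0)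
  have h0 : ∫ x in Set.Iic (-(K : ℝ) - 1), density0 f x = 0 :=
    setIntegral_eq_zero_of_forall_eq_zero fun x hx => density0_eq_zero hK fun h => by
      have := (abs_le.mp h).1
      have : x ≤ -(K : ℝ) - 1 := hx
      linarith
  have h1 : ∫ x in Set.Iic (K : ℝ), density0 f x = 1 := by
    rw [← hf.integral_density0]
    refine setIntegral_eq_integral_of_forall_compl_eq_zero fun x hx => density0_eq_zero hK fun h => ?_
    exact hx (abs_le.mp h).2
  -- Intermediate value theorem: the mass of `(-∞, m]` runs continuously from 0 to 1.
  obtain ⟨m, hm⟩ := mem_range_of_exists_le_of_exists_ge hc (c := 1 / 2)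
    ⟨_, by rw [h0]; norm_num⟩ ⟨_, by rw [h1]; norm_num⟩
  refine ⟨m, ?_⟩
  rw [key]
  simp only at hm
  rw [hm]; norm_num

/-! ### Joint entropy against marginal entropies -/

theorem hasCompactSupport_negMulLog {X : Type*} [TopologicalSpace X] {g : X → ℝ}
    (hg : HasCompactSupport g) : HasCompactSupport fun x => Real.negMulLog (g x) :=
  hg.comp_left (g := Real.negMulLog) Real.negMulLog_zero

theorem integrable_negMulLog (hf : IsDensity f) : Integrable fun p => Real.negMulLog (f p) :=
  (Real.continuous_negMulLog.comp hf.cont).integrable_of_hasCompactSupport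
    (hasCompactSupport_negMulLog hf.supp)

theorem integrable_negMulLog_density0 (hf : IsDensity f) :
    Integrable fun x => Real.negMulLog (density0 f x) :=
  (Real.continuous_negMulLog.comp hf.continuous_density0).integrable_of_hasCompactSupport
    (hasCompactSupport_negMulLog hf.hasCompactSupport_density0)

theorem density0_mul_log (x : ℝ) :
    density0 f x * Real.log (density0 f x) = -Real.negMulLog (density0 f x) := by
  simp [Real.negMulLog]

theorem integrable_mul_log_fst (hf : IsDensity f) :
    Integrable fun p : ℝ × ℝ => f p * Real.log (density0 f p.1) := by
  refine hf.integrable_mul_fst (g := fun x => Real.log (density0 f x))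
    (Real.measurable_log.comp hf.continuous_density0.measurable) ?_
  simpa only [density0_mul_log] using hf.integrable_negMulLog_density0.fun_neg

theorem integral_mul_log_fst (hf : IsDensity f) :
    ∫ p : ℝ × ℝ, f p * Real.log (density0 f p.1) = -diffEntropy (density0 f) := by
  rw [hf.integral_mul_fst (g := fun x => Real.log (density0 f x))
    (Real.measurable_log.comp hf.continuous_density0.measurable)]
  · simp only [density0_mul_log, integral_neg, diffEntropy]
  · simpa only [density0_mul_log] using hf.integrable_negMulLog_density0.fun_neg

theorem integrable_mul_log_snd (hf : IsDensity f) :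
    Integrable fun p : ℝ × ℝ => f p * Real.log (densityInf f p.2) :=
  hf.swap.integrable_mul_log_fst.swap

theorem integral_mul_log_snd (hf : IsDensity f) :
    ∫ p : ℝ × ℝ, f p * Real.log (densityInf f p.2) = -diffEntropy (densityInf f) := by
  rw [← integral_swap]
  exact hf.swap.integral_mul_log_fst

/-- Linearity in the sign makes the exponentially tilted product density integrable term by term. -/
theorem exp_mul_sign {l s : ℝ} (hs : s = -1 ∨ s = 1) :
    Real.exp (l * s) = Real.cosh l + Real.sinh l * s := by
  rcases hs with rfl | rfl
  · rw [mul_neg_one, mul_neg_one, ← sub_eq_add_neg, Real.cosh_sub_sinh]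
  · rw [mul_one, mul_one, Real.cosh_add_sinh]

/-- The pointwise Gibbs inequality `a log (b / a) ≤ b - a`. -/
theorem negMulLog_add_mul_log_le {a u v t : ℝ} (ha : 0 ≤ a) (hu : 0 ≤ u) (hv : 0 ≤ v)
    (hau : a ≠ 0 → 0 < u) (hav : a ≠ 0 → 0 < v) :
    Real.negMulLog a + a * Real.log u + a * Real.log v + a * t ≤ u * v * Real.exp t - a := by
  rcases ha.eq_or_lt with rfl | ha'
  · simp; positivity
  · have hu' := hau ha'.ne'
    have hv' := hav ha'.ne'
    have h1 := Real.log_le_sub_one_of_pos (x := u * v * Real.exp t / a) (by positivity)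
    rw [Real.log_div (by positivity) ha'.ne', Real.log_mul (by positivity) (by positivity),
      Real.log_mul hu'.ne' hv'.ne', Real.log_exp] at h1
    have h2 := mul_le_mul_of_nonneg_left h1 ha
    have h3 : a * (u * v * Real.exp t / a - 1) = u * v * Real.exp t - a := by field_simp
    rw [h3] at h2
    unfold Real.negMulLog
    linarith

theorem side_mul_side (m n x y : ℝ) :
    side m x * side n y = -1 ∨ side m x * side n y = 1 := by
  rcases side_eq m x with h | h <;> rcases side_eq n y with h' | h' <;> simp [h, h']

theorem integrable_mul_side (hf : IsDensity f) (m n : ℝ) :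
    Integrable fun p : ℝ × ℝ => f p * (side m p.1 * side n p.2) := by
  refine hf.integrable.mul_bdd (c := 1)
    (((measurable_side m).comp measurable_fst).mul
      ((measurable_side n).comp measurable_snd)).aestronglyMeasurable (.of_forall fun p => ?_)
  rcases side_mul_side m n p.1 p.2 with h | h <;> simp [h]

theorem integrable_density0_mul_side (hf : IsDensity f) (m : ℝ) :
    Integrable fun x => density0 f x * side m x := by
  refine hf.integrable_density0.mul_bdd (c := 1)
    (measurable_side m).aestronglyMeasurable (.of_forall fun p => ?_)
  rcases side_eq m p with h | h <;> simp [h]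

/-- Variational bound on the mutual information, tested against a product of signs. -/
theorem entropy_add_correlation_le (hf : IsDensity f) (l m n : ℝ)
    (hn : ∫ y, densityInf f y * side n y = 0) :
    (∫ p, Real.negMulLog (f p)) + l * ∫ p : ℝ × ℝ, f p * (side m p.1 * side n p.2) ≤
      diffEntropy (density0 f) + diffEntropy (densityInf f) + (Real.cosh l - 1) := by
  have i1 := hf.integrable_negMulLog
  have i2 := hf.integrable_mul_log_fst
  have i3 := hf.integrable_mul_log_snd
  have i4 := (hf.integrable_mul_side m n).const_mul l
  have j0 : Integrable (densityInf f) := hf.swap.integrable_density0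
  have j1 : Integrable fun p : ℝ × ℝ => density0 f p.1 * densityInf f p.2 :=
    hf.integrable_density0.mul_prod j0
  have j2 : Integrable fun p : ℝ × ℝ =>
      (density0 f p.1 * side m p.1) * (densityInf f p.2 * side n p.2) :=
    (hf.integrable_density0_mul_side m).mul_prod (hf.swap.integrable_density0_mul_side n)
  have e1 : ∫ p : ℝ × ℝ, density0 f p.1 * densityInf f p.2 = 1 := by
    rw [Measure.volume_eq_prod, integral_prod_mul, hf.integral_density0]
    rw [one_mul]; exact hf.swap.integral_density0
  -- The `sinh` term factors under the product density, so it vanishes as soon as one of the two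
  -- thresholds is a median.
  have e2 : ∫ p : ℝ × ℝ, (density0 f p.1 * side m p.1) * (densityInf f p.2 * side n p.2) = 0 := by
    rw [Measure.volume_eq_prod, integral_prod_mul (fun x => density0 f x * side m x)
      (fun y => densityInf f y * side n y), hn, mul_zero]
  have key : ∀ p : ℝ × ℝ, Real.negMulLog (f p) + f p * Real.log (density0 f p.1)
      + f p * Real.log (densityInf f p.2) + l * (f p * (side m p.1 * side n p.2)) ≤
      Real.cosh l * (density0 f p.1 * densityInf f p.2)
        + Real.sinh l * ((density0 f p.1 * side m p.1) * (densityInf f p.2 * side n p.2)) - f p := by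
    intro p
    have h := negMulLog_add_mul_log_le (t := l * (side m p.1 * side n p.2)) (hf.nonneg p)
      (hf.density0_nonneg p.1) (hf.swap.density0_nonneg p.2)
      (fun h => hf.density0_pos (x := p.1) (y := p.2) h)
      (fun h => hf.swap.density0_pos (x := p.2) (y := p.1) h)
    rw [exp_mul_sign (side_mul_side m n p.1 p.2), density0_swap] at h
    linarith
  have := integral_mono (((i1.add i2).add i3).add i4)
    (((j1.const_mul (Real.cosh l)).add (j2.const_mul (Real.sinh l))).sub hf.integrable) key
  rw [integral_add' ((i1.add i2).add i3) i4, integral_add' (i1.add i2) i3, integral_add' i1 i2,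
    integral_sub' ((j1.const_mul (Real.cosh l)).add (j2.const_mul (Real.sinh l))) hf.integrable,
    integral_add' (j1.const_mul (Real.cosh l)) (j2.const_mul (Real.sinh l)),
    integral_const_mul, integral_const_mul, integral_const_mul, e1, e2, hf.mass,
    hf.integral_mul_log_fst, hf.integral_mul_log_snd] at this
  linarith

/-- A quantitative bound: twice the largest projected entropy exceeds the joint entropy. -/
theorem joint_entropy_le (hf : IsDensity f) :
    (∫ p, Real.negMulLog (f p)) + 1 / 20 ≤
      2 * max (diffEntropy (density0 f))
        (max (diffEntropy (densityInf f)) (diffEntropy (density1 f))) := by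
  set M := max (diffEntropy (density0 f))
        (max (diffEntropy (densityInf f)) (diffEntropy (density1 f))) with hM
  have m0 : diffEntropy (density0 f) ≤ M := le_max_left _ _
  have m1 : diffEntropy (densityInf f) ≤ M := (le_max_left _ _).trans (le_max_right _ _)
  have m2 : diffEntropy (density1 f) ≤ M := (le_max_right _ _).trans (le_max_right _ _)
  obtain ⟨m, hm⟩ := hf.exists_median
  obtain ⟨n, hn⟩ := hf.swap.exists_median
  rw [density0_swap] at hn
  -- The bound is applied to `(X, Y)`, `(X + Y, X)` and `(X + Y, Y)`, with the signs of `l` as in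
  -- `side_identity`. Only `m` and `n` need be medians, not `m + n`. Writing `H` for the joint
  -- entropy, the sum reads `3H + 1/3 ≤ 6M + 3 (cosh (1/3) - 1)`.
  have a := hf.entropy_add_correlation_le (-(1 / 3)) m n hn
  have b := hf.shear.entropy_add_correlation_le (1 / 3) (m + n) m
    (by rw [densityInf_shear]; exact hm)
  have e0 : density0 (fun p : ℝ × ℝ => f ((p.2, p.1 - p.2) : ℝ × ℝ).swap) = density1 f :=
    density1_swap
  have e1 : densityInf (fun p : ℝ × ℝ => f ((p.2, p.1 - p.2) : ℝ × ℝ).swap) = densityInf f :=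
    densityInf_shear (f := fun p => f p.swap)
  have c := hf.swap.shear.entropy_add_correlation_le (1 / 3) (m + n) n (by rw [e1]; exact hn)
  rw [densityInf_shear, density0_shear] at b
  rw [e0, e1] at c
  rw [integral_shear (fun p => Real.negMulLog (f p))] at b
  rw [integral_shear (fun p => Real.negMulLog (f p.swap)),
    integral_swap (fun p => Real.negMulLog (f p))] at c
  have b' : ∫ p : ℝ × ℝ, f (p.2, p.1 - p.2) * (side (m + n) p.1 * side m p.2) =
      ∫ p : ℝ × ℝ, f p * (side (m + n) (p.1 + p.2) * side m p.1) := by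
    rw [← integral_shear fun p => f p * (side (m + n) (p.1 + p.2) * side m p.1)]; simp
  have c' : ∫ p : ℝ × ℝ, f ((p.2, p.1 - p.2) : ℝ × ℝ).swap * (side (m + n) p.1 * side n p.2) =
      ∫ p : ℝ × ℝ, f p * (side (m + n) (p.1 + p.2) * side n p.2) := by
    rw [← integral_swap fun p => f p * (side (m + n) (p.1 + p.2) * side n p.2),
      ← integral_shear fun p => f p.swap * (side (m + n) (p.swap.1 + p.swap.2) * side n p.swap.2)]
    simp
  rw [b'] at b
  rw [c'] at c
  have ms : ∀ k, Measurable (side k) := measurable_side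
  have hint : ∀ g : ℝ × ℝ → ℝ, Measurable g → (∀ p, g p = -1 ∨ g p = 1) →
      Integrable fun p => f p * g p := by
    intro g hg h
    refine hf.integrable.mul_bdd (c := 1) hg.aestronglyMeasurable (.of_forall fun p => ?_)
    rcases h p with h | h <;> simp [h]
  have ib := hint (fun p => side (m + n) (p.1 + p.2) * side m p.1)
    (((ms _).comp (measurable_fst.add measurable_snd)).mul ((ms _).comp measurable_fst))
    fun p => side_mul_side _ _ _ _
  have ic := hint (fun p => side (m + n) (p.1 + p.2) * side n p.2)
    (((ms _).comp (measurable_fst.add measurable_snd)).mul ((ms _).comp measurable_snd))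
    fun p => side_mul_side _ _ _ _
  have id : (∫ p : ℝ × ℝ, f p * (side (m + n) (p.1 + p.2) * side m p.1))
      + (∫ p : ℝ × ℝ, f p * (side (m + n) (p.1 + p.2) * side n p.2))
      - (∫ p : ℝ × ℝ, f p * (side m p.1 * side n p.2)) = 1 := by
    rw [← integral_add ib ic, ← integral_sub (ib.fun_add ic) (hf.integrable_mul_side m n), ← hf.mass]
    congr 1
    funext p
    have := side_identity m n p.1 p.2
    linear_combination f p * this
  -- `cosh (1/3) ≤ exp (1/18) ≤ 1 / (1 - 1/18) = 18/17`, and `1/9 - 1/17 = 8/153 > 1/20`.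
  have hcosh : Real.cosh (1 / 3) - 1 ≤ 1 / 17 := by
    have h1 := Real.cosh_le_exp_half_sq (1 / 3)
    have h2 := Real.add_one_le_exp (-((1 / 3) ^ 2 / 2) : ℝ)
    rw [Real.exp_neg] at h2
    have h3 : Real.exp ((1 / 3) ^ 2 / 2) ≤ 18 / 17 := by
      have := inv_anti₀ (by norm_num) h2
      rw [inv_inv] at this
      exact this.trans (by norm_num)
    linarith
  rw [Real.cosh_neg] at a
  linarith

end IsDensity

/-! ### Folding and entropy -/

theorem continuous_integral_fst {h : ℝ × ℝ → ℝ} (hc : Continuous h) {R : ℝ}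
    (hR : ∀ x y, h (x, y) ≠ 0 → |x| ≤ R) : Continuous fun y => ∫ x, h (x, y) := by
  have : (fun y => ∫ x, h (x, y)) = fun y => ∫ x in Set.Icc (-R) R, h (x, y) := by
    funext y
    refine (setIntegral_eq_integral_of_forall_compl_eq_zero fun x hx => ?_).symm
    by_contra h
    exact hx (abs_le.mp (hR x y h))
  rw [this]
  exact continuous_parametric_integral_of_continuous (f := fun y x => h (x, y))
    (hc.comp continuous_swap) isCompact_Icc

theorem integrable_of_abs_le {g : ℝ → ℝ} (hc : Continuous g) {R : ℝ}
    (hR : ∀ x, g x ≠ 0 → |x| ≤ R) : Integrable g := by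
  refine hc.integrable_of_hasCompactSupport
    (HasCompactSupport.intro (isCompact_Icc (a := -R) (b := R)) fun x hx => ?_)
  by_contra h
  exact hx (abs_le.mp (hR x h))

/-- Each nonzero term has logarithm at most that of the whole sum. -/
theorem negMulLog_sum_le {ι : Type*} (s : Finset ι) {g : ι → ℝ} (hg : ∀ i, 0 ≤ g i) :
    Real.negMulLog (∑ i ∈ s, g i) ≤ ∑ i ∈ s, Real.negMulLog (g i) := by
  simp only [Real.negMulLog, neg_mul, Finset.sum_neg_distrib, Finset.sum_mul]
  refine neg_le_neg (Finset.sum_le_sum fun i hi => ?_)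
  rcases (hg i).eq_or_lt with h | h
  · simp [← h]
  · exact mul_le_mul_of_nonneg_left
      (Real.log_le_log h (Finset.single_le_sum (fun j _ => hg j) hi)) (hg i)

namespace IsDensity

variable {f : ℝ × ℝ → ℝ}

/-- From `0 ≤ y < 1` and `|y + j| ≤ K` one gets `-K - 1 < j ≤ K`. The range does not depend on `t`,
so the folding is jointly continuous in slope and point. -/
theorem folded_eq_sum {K : ℕ} (hK : ∀ x y, f (x, y) ≠ 0 → |x| ≤ K ∧ |y| ≤ K) (t x : ℝ) {y : ℝ}
    (hy : y ∈ Set.Ico (0 : ℝ) 1) :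
    folded t f x y = ∑ j ∈ Finset.Icc (-(K : ℤ) - 1) K, f (x - t * j, y + j) := by
  refine tsum_eq_sum fun j hj => ?_
  by_contra h
  have h2 := abs_le.mp (hK _ _ h).2
  refine hj (Finset.mem_Icc.mpr ⟨?_, ?_⟩)
  · have : (-(K : ℤ) - 1 : ℝ) < j := by push_cast; linarith [h2.1, hy.2]
    exact_mod_cast this.le
  · have : (j : ℝ) ≤ (K : ℤ) := by push_cast; linarith [h2.2, hy.1]
    exact_mod_cast this

theorem foldSum_support {K : ℕ} (hK : ∀ x y, f (x, y) ≠ 0 → |x| ≤ K ∧ |y| ≤ K) {t x y : ℝ}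
    (h : ∑ j ∈ Finset.Icc (-(K : ℤ) - 1) K, f (x - t * j, y + j) ≠ 0) :
    |x| ≤ K + |t| * (K + 1) := by
  obtain ⟨j, hj, hne⟩ := Finset.exists_ne_zero_of_sum_ne_zero h
  obtain ⟨h1, h2⟩ := Finset.mem_Icc.mp hj
  have h3 : |(j : ℝ)| ≤ K + 1 := by
    have a : (-(K : ℤ) - 1 : ℝ) ≤ j := by exact_mod_cast h1
    have b : (j : ℝ) ≤ (K : ℤ) := by exact_mod_cast h2
    push_cast at a b
    exact abs_le.mpr ⟨by linarith, by linarith⟩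
  calc |x| = |(x - t * j) + t * j| := by ring_nf
    _ ≤ |x - t * j| + |t * j| := abs_add_le _ _
    _ ≤ K + |t| * (K + 1) := by
      rw [abs_mul]
      exact add_le_add (hK _ _ hne).1 (mul_le_mul_of_nonneg_left h3 (abs_nonneg _))

theorem continuous_foldSum (hf : IsDensity f) (J : Finset ℤ) :
    Continuous fun q : ℝ × ℝ × ℝ => ∑ j ∈ J, f (q.2.1 - q.1 * j, q.2.2 + j) :=
  continuous_finsetSum _ fun j _ => hf.cont.comp (by fun_prop)

/-- Folding does not increase entropy. -/
theorem stripEntropy_folded_le (hf : IsDensity f) (t : ℝ) :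
    stripEntropy (folded t f) ≤ ∫ p, Real.negMulLog (f p) := by
  obtain ⟨K, hK⟩ := hf.exists_box
  set J := Finset.Icc (-(K : ℤ) - 1) (K : ℤ) with hJ
  set N := Real.negMulLog with hN
  have cN : Continuous N := Real.continuous_negMulLog
  set G : ℝ → ℝ := fun y => ∫ x, N (f (x, y)) with hG
  have sN : ∀ x y, N (f (x, y)) ≠ 0 → |x| ≤ K ∧ |y| ≤ K := fun x y h =>
    hK x y fun h0 => h (by rw [h0]; exact Real.negMulLog_zero)
  have cG : Continuous G :=
    continuous_integral_fst (cN.comp hf.cont) fun x y h => (sN x y h).1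
  have sG : ∀ y, G y ≠ 0 → |y| ≤ K := by
    intro y h
    by_contra h0
    refine h ?_
    have : ∀ x, N (f (x, y)) = 0 := fun x => by
      by_contra h1
      exact h0 (sN x y h1).2
    simp [hG, this]
  have iG : Integrable G := integrable_of_abs_le cG sG
  have cfold : Continuous fun p : ℝ × ℝ => ∑ j ∈ J, f (p.1 - t * j, p.2 + j) :=
    (hf.continuous_foldSum J).comp (by fun_prop : Continuous fun p : ℝ × ℝ => (t, p))
  have sfold : ∀ x y, N (∑ j ∈ J, f (x - t * j, y + j)) ≠ 0 → |x| ≤ K + |t| * (K + 1) :=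
    fun x y h => foldSum_support hK fun h0 => h (by rw [h0]; exact Real.negMulLog_zero)
  have ish : ∀ y, ∀ j : ℤ, Integrable fun x => N (f (x - t * j, y + j)) := fun y j =>
    Integrable.comp_sub_right (f := fun x => N (f (x, y + j)))
      (integrable_of_abs_le (cN.comp (hf.cont.comp (by fun_prop))) fun x h => (sN x _ h).1) (t * j)
  calc stripEntropy (folded t f)
      = ∫ y in Set.Ico (0 : ℝ) 1, ∫ x, N (∑ j ∈ J, f (x - t * j, y + j)) := by
        refine setIntegral_congr_fun measurableSet_Ico fun y hy => ?_
        simp only [folded_eq_sum hK t _ hy, hN, hJ]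
    -- Subadditivity holds pointwise; integrating over `x` then removes the shifts `t * j` by
    -- translation invariance.
    _ ≤ ∫ y in Set.Ico (0 : ℝ) 1, ∑ j ∈ J, G (y + j) := by
        refine setIntegral_mono_on ?_ ?_ measurableSet_Ico fun y _ => ?_
        · exact ((continuous_integral_fst (cN.comp cfold) sfold).integrableOn_Icc
            (a := 0) (b := 1)).mono_set Set.Ico_subset_Icc_self
        · exact (continuous_finsetSum J fun j _ => cG.comp (by fun_prop :
            Continuous fun y : ℝ => y + j)).integrableOn_Icc.mono_set Set.Ico_subset_Icc_self
        · have : ∑ j ∈ J, G (y + j) = ∫ x, ∑ j ∈ J, N (f (x - t * j, y + j)) := by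
            rw [integral_finsetSum _ fun j _ => ish y j]
            exact Finset.sum_congr rfl fun j _ =>
              (integral_sub_right_eq_self (fun x => N (f (x, y + j))) (t * j)).symm
          rw [this]
          refine integral_mono (integrable_of_abs_le (cN.comp (cfold.comp (by fun_prop :
            Continuous fun x : ℝ => (x, y)))) fun x h => sfold x y h)
            (integrable_finsetSum _ fun j _ => ish y j) fun x => ?_
          exact negMulLog_sum_le J fun j => hf.nonneg _
    _ = ∑ j ∈ J, ∫ y in Set.Ico (j : ℝ) (j + 1), G y := by
        rw [integral_finsetSum J fun (j : ℤ) _ => (iG.comp_add_right (j : ℝ)).integrableOn]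
        refine Finset.sum_congr rfl fun j _ => ?_
        rw [integral_Ico_eq_integral_Ioc, integral_Ico_eq_integral_Ioc,
          ← intervalIntegral.integral_of_le zero_le_one,
          ← intervalIntegral.integral_of_le (by linarith),
          intervalIntegral.integral_comp_add_right]
        congr 1 <;> ring
    _ = ∫ y, G y := by
        have h := integral_iUnion (μ := volume) (f := G)
          (fun n : ℤ => measurableSet_Ico (a := (n : ℝ)) (b := n + 1))
          (Set.pairwise_disjoint_Ico_intCast ℝ) iG.integrableOn
        rw [iUnion_Ico_intCast, setIntegral_univ] at h
        rw [h]
        refine (tsum_eq_sum fun j hj => ?_).symm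
        refine setIntegral_eq_zero_of_forall_eq_zero fun y hy => ?_
        by_contra h
        have h2 := abs_le.mp (sG y h)
        refine hj (Finset.mem_Icc.mpr ⟨?_, ?_⟩)
        · have : (-(K : ℤ) - 1 : ℝ) ≤ j := by push_cast; linarith [h2.1, hy.2]
          exact_mod_cast this
        · have : (j : ℝ) ≤ (K : ℤ) := by push_cast; linarith [h2.2, hy.1]
          exact_mod_cast this
    _ = ∫ p, N (f p) := by
        rw [hG, Measure.volume_eq_prod, integral_prod_symm _ hf.integrable_negMulLog]

theorem le_functional (hf : IsDensity f) (t : ℝ) : 1 / 20 ≤ functional t f := by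
  have := hf.stripEntropy_folded_le t
  have := hf.joint_entropy_le
  unfold functional
  linarith

end IsDensity

theorem exists_isTestDensity : ∃ f, IsTestDensity f := by
  let φ : ContDiffBump (0 : ℝ × ℝ) := ⟨1, 2, by norm_num, by norm_num⟩
  exact ⟨φ.normed volume, φ.contDiff_normed, φ.hasCompactSupport_normed, φ.nonneg_normed,
    φ.integral_normed⟩

/-! ### Finitely supported distributions and their projections -/

/-- Mass of the fibre of `κ` over `k` for the weight `w`. -/
def fiberMass {P K : Type*} (w : P → ℝ) (κ : P → K) (k : K) : ℝ :=
  ∑' p, (κ ⁻¹' {k}).indicator w p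

theorem fiberMass_eq_tsum {P K J : Type*} (w : P → ℝ) (κ : P → K) (k : K) {φ : J → P}
    (hφ : Function.Injective φ) (hr : Set.range φ = κ ⁻¹' {k}) :
    fiberMass w κ k = ∑' j, w (φ j) := by
  unfold fiberMass
  rw [← hφ.tsum_eq (f := (κ ⁻¹' {k}).indicator w) (hr ▸ Set.support_indicator_subset)]
  refine tsum_congr fun j => Set.indicator_of_mem (hr ▸ Set.mem_range_self j) _

theorem fiberMass_support {P K : Type*} (w : P → ℝ) (κ : P → K) :
    Function.support (fiberMass w κ) ⊆ κ '' Function.support w := by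
  intro k hk
  by_contra h
  refine hk ?_
  have : ∀ p, (κ ⁻¹' {k}).indicator w p = 0 := fun p => by
    refine Set.indicator_apply_eq_zero.mpr fun hp => ?_
    by_contra h0
    exact h ⟨p, h0, hp⟩
  simp [fiberMass, this]

theorem tsum_fiberMass {P K : Type*} {w : P → ℝ} (hw : (Function.support w).Finite) (κ : P → K) :
    ∑' k, fiberMass w κ k = ∑' p, w p := by
  classical
  unfold fiberMass
  have hs : Summable (Function.uncurry fun k p => (κ ⁻¹' {k}).indicator w p) := by
    refine summable_of_hasFiniteSupport ((hw.image fun p => (κ p, p)).subset ?_)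
    rintro ⟨k, p⟩ h
    have h1 : p ∈ κ ⁻¹' {k} ∩ Function.support w := by
      rw [← Set.support_indicator]; exact h
    exact ⟨p, h1.2, Prod.ext h1.1 rfl⟩
  rw [← hs.tsum_comm (f := fun k p => (κ ⁻¹' {k}).indicator w p)]
  refine tsum_congr fun p => ?_
  rw [tsum_eq_single (κ p) fun k hk =>
    Set.indicator_of_notMem (s := κ ⁻¹' {k}) (fun h => hk (Eq.symm h)) w]
  exact Set.indicator_of_mem (s := κ ⁻¹' {κ p}) rfl w

/-- Rescaling of the entropy of a finitely supported distribution. -/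
theorem tsum_negMulLog_rescale {K : Type*} {m : K → ℝ} (hm : (Function.support m).Finite)
    (h1 : ∑' k, m k = 1) {c : ℝ} (hc : 0 < c) :
    ∑' k, Real.negMulLog (m k) = Real.log c + c⁻¹ * ∑' k, Real.negMulLog (c * m k) := by
  have e : ∀ k, Real.negMulLog (m k) = m k * Real.log c + c⁻¹ * Real.negMulLog (c * m k) := by
    intro k
    rw [Real.negMulLog_mul, Real.negMulLog]
    field_simp
    simp only [Real.negMulLog]
    ring
  have s1 : Summable fun k => m k * Real.log c :=
    (summable_of_hasFiniteSupport hm).mul_right _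
  have s2 : Summable fun k => c⁻¹ * Real.negMulLog (c * m k) := by
    refine summable_of_hasFiniteSupport (hm.subset fun k hk h0 => hk ?_)
    simp [h0]
  rw [tsum_congr e, s1.tsum_add s2, tsum_mul_right, h1, one_mul, tsum_mul_left]

/-- A finitely supported distribution on the lattice is realised by integer random variables. -/
theorem exists_random_variables {w : ℤ × ℤ → ℝ} (h0 : ∀ p, 0 ≤ w p)
    (hfin : (Function.support w).Finite) (h1 : ∑' p, w p = 1) :
    ∃ (Ω : Type) (_ : MeasurableSpace Ω) (μ : Measure Ω) (_ : IsProbabilityMeasure μ)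
      (X Y : Ω → ℚ), Measurable X ∧ Measurable Y ∧ (Set.range X).Finite ∧ (Set.range Y).Finite ∧
      ∀ Z : ℚ → ℚ → ℚ, ∀ q, μ.real ((fun u => Z (X u) (Y u)) ⁻¹' {q}) =
        fiberMass w (fun p => Z p.1 p.2) q := by
  classical
  set s := hfin.toFinset with hs
  have hsum : ∀ A : Set (ℤ × ℤ), ∑' p, A.indicator w p = ∑ p : s, A.indicator w p := by
    intro A
    rw [tsum_eq_sum (s := s), ← Finset.sum_coe_sort]
    intro p hp
    refine Set.indicator_apply_eq_zero.mpr fun _ => ?_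
    by_contra h
    exact hp (hfin.mem_toFinset.mpr h)
  let μ : @Measure s ⊤ := ∑ p : s, ENNReal.ofReal (w p) • @Measure.dirac s ⊤ p
  have hμ : ∀ A : Set (ℤ × ℤ), μ ((fun p : s => (p : ℤ × ℤ)) ⁻¹' A) =
      ENNReal.ofReal (∑' p, A.indicator w p) := by
    intro A
    rw [hsum, ENNReal.ofReal_sum_of_nonneg fun p _ => Set.indicator_nonneg (fun _ _ => h0 _) _]
    simp only [μ, Measure.coe_finsetSum, Finset.sum_apply, Measure.smul_apply]
    refine Finset.sum_congr rfl fun p _ => ?_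
    rw [@Measure.dirac_apply' s ⊤ _ p MeasurableSpace.measurableSet_top]
    by_cases hp : (p : ℤ × ℤ) ∈ A <;> simp [hp]
  refine ⟨s, ⊤, μ, ⟨?_⟩, fun p => (p : ℤ × ℤ).1, fun p => (p : ℤ × ℤ).2, measurable_from_top,
    measurable_from_top, Set.finite_range _, Set.finite_range _, fun Z q => ?_⟩
  · have := hμ Set.univ
    simpa [h1] using this
  · have := hμ ((fun p : ℤ × ℤ => Z p.1 p.2) ⁻¹' {q})
    rw [Measure.real, fiberMass, ← ENNReal.toReal_ofReal
      (tsum_nonneg fun p => Set.indicator_nonneg (fun _ _ => h0 _) p), ← this]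
    rfl

/-- Relabelling the values of a projection by an injection. -/
theorem tsum_negMulLog_fiberMass {P K : Type*} (w : P → ℝ) (κ : P → K) {e : K → ℚ}
    (he : Function.Injective e) :
    ∑' q, Real.negMulLog (fiberMass w (fun p => e (κ p)) q) =
      ∑' k, Real.negMulLog (fiberMass w κ k) := by
  rw [← he.tsum_eq]
  · refine tsum_congr fun k => ?_
    congr 2
    have : (fun p => e (κ p)) ⁻¹' {e k} = κ ⁻¹' {k} := by
      ext p; simp [he.eq_iff]
    simp only [fiberMass, this]
  · intro q hq
    by_contra h
    refine hq ?_
    have : (fun p => e (κ p)) ⁻¹' {q} = ∅ := by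
      ext p
      simp only [Set.mem_preimage, Set.mem_singleton_iff, Set.mem_empty_iff_false, iff_false]
      exact fun h1 => h ⟨_, h1⟩
    simp [fiberMass, this]

/-! ### The projection of slope `a/b` on the integer lattice -/

/-- The coset representative of `p` modulo `(a, -b)` with second coordinate in `[0, b)`. -/
def stripProj (a b : ℤ) (hb : 0 < b) (p : ℤ × ℤ) : {p : ℤ × ℤ // p.2 ∈ Set.Ico 0 b} :=
  ⟨(p.1 + a * (p.2 / b), p.2 % b), Int.emod_nonneg _ hb.ne', Int.emod_lt_of_pos _ hb⟩

theorem stripProj_fiber {a b : ℤ} (hb : 0 < b) (k : {p : ℤ × ℤ // p.2 ∈ Set.Ico 0 b}) :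
    Set.range (fun j : ℤ => (k.1.1 - a * j, k.1.2 + b * j)) = stripProj a b hb ⁻¹' {k} := by
  obtain ⟨⟨x, y⟩, h0, h1⟩ := k
  simp only at h0 h1
  ext ⟨u, v⟩
  simp only [Set.mem_range, Set.mem_preimage, Set.mem_singleton_iff, stripProj, Subtype.ext_iff,
    Prod.mk.injEq]
  constructor
  · rintro ⟨j, rfl, rfl⟩
    rw [Int.add_mul_ediv_left _ _ hb.ne', Int.ediv_eq_zero_of_lt h0 h1, Int.add_mul_emod_self_left,
      Int.emod_eq_of_lt h0 h1]
    exact ⟨by ring, rfl⟩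
  · rintro ⟨rfl, rfl⟩
    exact ⟨v / b, by ring, by rw [add_comm]; exact Int.mul_ediv_add_emod v b⟩

theorem stripProj_fiber_injective {a b : ℤ} (hb : 0 < b) (x y : ℤ) :
    Function.Injective (fun j : ℤ => (x - a * j, y + b * j)) := by
  intro i j h
  have := (Prod.mk.inj h).2
  exact mul_left_cancel₀ hb.ne' (by linarith)

/-- Equal values give `b ∣ a (y - y')`, hence `b ∣ y - y'` by coprimality, while `|y - y'| < b`. -/
theorem strip_value_injective {a b : ℤ} (hb : 0 < b) (hab : IsCoprime a b) :
    Function.Injective fun k : {p : ℤ × ℤ // p.2 ∈ Set.Ico 0 b} =>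
      (k.1.1 : ℚ) + (a / b : ℚ) * (k.1.2 : ℚ) := by
  rintro ⟨⟨x, y⟩, h0, h1⟩ ⟨⟨x', y'⟩, h0', h1'⟩ h
  simp only at h h0 h1 h0' h1'
  have hbq : (b : ℚ) ≠ 0 := by exact_mod_cast hb.ne'
  field_simp at h
  have h2 : b * x + a * y = b * x' + a * y' := by
    exact_mod_cast (by linear_combination h : (b : ℚ) * x + a * y = b * x' + a * y')
  have h3 : b ∣ a * (y - y') := ⟨x' - x, by linarith⟩
  have h4 : b ∣ y - y' := hab.symm.dvd_of_dvd_mul_left h3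
  have h5 : y - y' = 0 := Int.eq_zero_of_abs_lt_dvd h4 (by rw [abs_lt]; constructor <;> linarith)
  have h6 : y = y' := by linarith
  subst h6
  have : x = x' := mul_left_cancel₀ hb.ne' (by linarith)
  subst this
  rfl

/-- The vector `(a, -b)` lies in the kernel of the projection. -/
theorem strip_value {a b : ℤ} (hb : 0 < b) (p : ℤ × ℤ) :
    (p.1 : ℚ) + (a / b : ℚ) * (p.2 : ℚ) =
      ((stripProj a b hb p).1.1 : ℚ) + (a / b : ℚ) * ((stripProj a b hb p).1.2 : ℚ) := by
  have hbq : (b : ℚ) ≠ 0 := by exact_mod_cast hb.ne'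
  have h : (b : ℚ) * ((p.2 / b : ℤ) : ℚ) + ((p.2 % b : ℤ) : ℚ) = p.2 := by
    exact_mod_cast Int.mul_ediv_add_emod p.2 b
  simp only [stripProj]
  push_cast
  rw [← h]
  field_simp
  ring

/-! ### Riemann sums as integrals of step functions -/

theorem finite_support_of_abs_le {g : ℤ → ℝ} {B R : ℝ} (hB : 0 < B)
    (hR : ∀ k : ℤ, g k ≠ 0 → |k / B| ≤ R) : (Function.support g).Finite := by
  refine (Set.finite_Icc ⌈-(R * B)⌉ ⌊R * B⌋).subset fun k hk => ?_
  have h := hR k hk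
  rw [abs_div, abs_of_pos hB, div_le_iff₀ hB, abs_le] at h
  exact ⟨Int.ceil_le.mpr h.1, Int.le_floor.mpr h.2⟩

theorem abs_le_of_floor {B R x : ℝ} (hB : 1 ≤ B) (h : |(⌊B * x⌋ : ℝ) / B| ≤ R) : |x| ≤ R + 1 := by
  have hB0 : 0 < B := by linarith
  have h1 := Int.floor_le (B * x)
  have h2 := Int.lt_floor_add_one (B * x)
  have h3 : (⌊B * x⌋ : ℝ) / B ≤ x := by rw [div_le_iff₀ hB0]; linarith
  have h4 : x ≤ (⌊B * x⌋ : ℝ) / B + 1 := by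
    have : x ≤ ((⌊B * x⌋ : ℝ) + 1) / B := by rw [le_div_iff₀ hB0]; linarith
    rw [add_div] at this
    have : 1 / B ≤ 1 := by rw [div_le_one hB0]; exact hB
    linarith
  rw [abs_le] at h ⊢
  constructor <;> linarith

theorem measurable_step (g : ℤ → ℝ) (B : ℝ) : Measurable fun x : ℝ => g ⌊B * x⌋ :=
  (measurable_from_top (f := g)).comp (Int.measurable_floor.comp (measurable_const_mul B))

theorem integral_step {g : ℤ → ℝ} (hg : (Function.support g).Finite) {B : ℝ} (hB : 0 < B) :
    ∫ x : ℝ, g ⌊B * x⌋ = B⁻¹ * ∑' k, g k := by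
  have hmeas : Measurable fun x : ℝ => g ⌊x⌋ := (measurable_from_top (f := g)).comp Int.measurable_floor
  obtain ⟨D, hD⟩ := (hg.image fun k => ‖g k‖).bddAbove
  have hD' : ∀ k, ‖g k‖ ≤ max D 0 := fun k => by
    by_cases h : g k = 0
    · simp [h]
    · exact (hD ⟨k, h, rfl⟩).trans (le_max_left _ _)
  obtain ⟨lo, hlo⟩ := hg.bddBelow
  obtain ⟨hi, hhi⟩ := hg.bddAbove
  have hint : Integrable fun x : ℝ => g ⌊x⌋ := by
    have hs : Function.support (fun x : ℝ => g ⌊x⌋) ⊆ Set.Icc (lo : ℝ) (hi + 1) := by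
      intro x hx
      have h1 : (lo : ℝ) ≤ ⌊x⌋ := by exact_mod_cast hlo hx
      have h2 : (⌊x⌋ : ℝ) ≤ hi := by exact_mod_cast hhi hx
      exact ⟨h1.trans (Int.floor_le x), by linarith [Int.lt_floor_add_one x]⟩
    rw [← integrableOn_iff_integrable_of_support_subset hs]
    exact Measure.integrableOn_of_bounded (M := max D 0) (by simp)
      hmeas.aestronglyMeasurable (.of_forall fun x => hD' _)
  rw [Measure.integral_comp_mul_left (fun x => g ⌊x⌋) B, abs_of_pos (inv_pos.mpr hB), smul_eq_mul]
  congr 1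
  have h := integral_iUnion (μ := volume) (f := fun x : ℝ => g ⌊x⌋)
    (fun n : ℤ => measurableSet_Ico (a := (n : ℝ)) (b := n + 1))
    (Set.pairwise_disjoint_Ico_intCast ℝ) hint.integrableOn
  rw [iUnion_Ico_intCast, setIntegral_univ] at h
  rw [h]
  refine tsum_congr fun n => ?_
  have : ∫ x in Set.Ico (n : ℝ) (n + 1), g ⌊x⌋ = ∫ x in Set.Ico (n : ℝ) (n + 1), g n :=
    setIntegral_congr_fun measurableSet_Ico fun x hx => by
      simp only [Int.floor_eq_iff.mpr ⟨hx.1, hx.2⟩]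
  rw [this]
  simp

theorem step_le_indicator {g : ℤ → ℝ} {B D R : ℝ} (hB : 1 ≤ B) (hD : ∀ k, |g k| ≤ D)
    (hR : ∀ k : ℤ, g k ≠ 0 → |k / B| ≤ R) (x : ℝ) :
    ‖g ⌊B * x⌋‖ ≤ (Set.Icc (-(R + 1)) (R + 1)).indicator (fun _ => D) x := by
  by_cases h : g ⌊B * x⌋ = 0
  · rw [h, norm_zero]
    exact Set.indicator_nonneg (fun _ _ => (abs_nonneg _).trans (hD 0)) _
  · have hx : x ∈ Set.Icc (-(R + 1)) (R + 1) := abs_le.mp (abs_le_of_floor hB (hR _ h))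
    rw [Set.indicator_of_mem hx]
    exact hD _

theorem integrable_indicator_box (D R : ℝ) :
    Integrable ((Set.Icc (-(R + 1)) (R + 1)).indicator fun _ => D) :=
  (integrable_indicator_iff measurableSet_Icc).mpr (integrableOn_const (by simp))

/-- Serves to bound inner sums uniformly when Riemann sums are iterated. Rounding down moves a point
by at most `1 / B ≤ 1`, whence `R + 1`. -/
theorem abs_riemann_le {g : ℤ → ℝ} {B D R : ℝ} (hB : 1 ≤ B) (hR0 : 0 ≤ R) (hD : ∀ k, |g k| ≤ D)
    (hR : ∀ k : ℤ, g k ≠ 0 → |k / B| ≤ R) : |B⁻¹ * ∑' k, g k| ≤ 2 * (R + 1) * D := by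
  have hB0 : 0 < B := by linarith
  rw [← integral_step (finite_support_of_abs_le hB0 hR) hB0, ← Real.norm_eq_abs]
  refine (norm_integral_le_of_norm_le (integrable_indicator_box D R)
    (.of_forall (step_le_indicator hB hD hR))).trans (le_of_eq ?_)
  rw [integral_indicator_const _ measurableSet_Icc, Real.volume_real_Icc_of_le (by linarith),
    smul_eq_mul]
  ring

/-- Convergence of Riemann sums of varying lattice functions. -/
theorem tendsto_riemann {ι : Type*} {l : Filter ι} [l.IsCountablyGenerated] {B : ι → ℝ}
    (hB : Tendsto B l atTop) {g : ι → ℤ → ℝ} {G : ℝ → ℝ} {D R : ℝ}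
    (hD : ∀ᶠ i in l, ∀ k, |g i k| ≤ D) (hR : ∀ᶠ i in l, ∀ k : ℤ, g i k ≠ 0 → |k / B i| ≤ R)
    (hG : ∀ x, Tendsto (fun i => g i ⌊B i * x⌋) l (𝓝 (G x))) :
    Tendsto (fun i => (B i)⁻¹ * ∑' k, g i k) l (𝓝 (∫ x, G x)) := by
  have hB1 := hB.eventually_ge_atTop 1
  -- By `integral_step` the sum is the integral of a step function, so pointwise convergence and a
  -- fixed bounded box suffice.
  have h := tendsto_integral_filter_of_dominated_convergence (μ := volume) (l := l)
    (F := fun i x => g i ⌊B i * x⌋) (f := G) ((Set.Icc (-(R + 1)) (R + 1)).indicator fun _ => D)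
    (.of_forall fun i => (measurable_step _ _).aestronglyMeasurable)
    (by
      filter_upwards [hD, hR, hB1] with i h1 h2 h3
      exact .of_forall (step_le_indicator h3 h1 h2))
    (integrable_indicator_box D R) (.of_forall hG)
  refine h.congr' ?_
  filter_upwards [hR, hB1] with i h2 h3
  exact integral_step (finite_support_of_abs_le (by linarith) h2) (by linarith)

theorem tendsto_floor_div {ι : Type*} {l : Filter ι} {B : ι → ℝ} (hB : Tendsto B l atTop) (x : ℝ) :
    Tendsto (fun i => (⌊B i * x⌋ : ℝ) / B i) l (𝓝 x) := by
  have h1 : Tendsto (fun i => x - (B i)⁻¹) l (𝓝 x) := by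
    simpa using (tendsto_const_nhds (x := x)).sub (tendsto_inv_atTop_zero.comp hB)
  refine tendsto_of_tendsto_of_tendsto_of_le_of_le' h1 tendsto_const_nhds ?_ ?_
  · filter_upwards [hB.eventually_gt_atTop 0] with i hi
    rw [le_div_iff₀ hi, sub_mul, inv_mul_cancel₀ hi.ne']
    linarith [Int.lt_floor_add_one (B i * x)]
  · filter_upwards [hB.eventually_gt_atTop 0] with i hi
    rw [div_le_iff₀ hi]
    linarith [Int.floor_le (B i * x)]

/-! ### Entropies of lattice samples -/

/-- Total mass of the samples of `f` on the lattice of mesh `1 / B`. -/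
def latticeMass (f : ℝ × ℝ → ℝ) (B : ℝ) : ℝ := ∑' p : ℤ × ℤ, f (p.1 / B, p.2 / B)

/-- Entropy of the first coordinate of the normalised lattice samples of `f`. -/
def rowEntropy (f : ℝ × ℝ → ℝ) (B : ℝ) : ℝ :=
  ∑' k : ℤ, Real.negMulLog ((∑' j : ℤ, f (k / B, j / B)) / latticeMass f B)

/-- Entropy of the folding of the normalised lattice samples of `f`. -/
def foldEntropy (f : ℝ × ℝ → ℝ) (a b : ℤ) : ℝ :=
  ∑' p : {p : ℤ × ℤ // p.2 ∈ Set.Ico 0 b},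
    Real.negMulLog (folded (a / b) f (p.1.1 / b) (p.1.2 / b) / latticeMass f b)

namespace IsDensity

variable {f : ℝ × ℝ → ℝ}

theorem finite_support_samples (hf : IsDensity f) {B : ℝ} (hB : 0 < B) :
    (Function.support fun p : ℤ × ℤ => f (p.1 / B, p.2 / B)).Finite := by
  obtain ⟨K, hK⟩ := hf.exists_box
  refine ((Set.finite_Icc ⌈-(K * B)⌉ ⌊K * B⌋).prod (Set.finite_Icc ⌈-(K * B)⌉ ⌊K * B⌋)).subset ?_
  rintro ⟨i, j⟩ h
  obtain ⟨h1, h2⟩ := hK _ _ h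
  rw [abs_div, abs_of_pos hB, div_le_iff₀ hB, abs_le] at h1 h2
  exact ⟨⟨Int.ceil_le.mpr h1.1, Int.le_floor.mpr h1.2⟩, Int.ceil_le.mpr h2.1, Int.le_floor.mpr h2.2⟩

theorem latticeMass_eq (hf : IsDensity f) {B : ℝ} (hB : 0 < B) :
    latticeMass f B = ∑' k : ℤ, ∑' j : ℤ, f (k / B, j / B) :=
  (summable_of_hasFiniteSupport (hf.finite_support_samples hB)).tsum_prod

theorem latticeMass_swap (B : ℝ) : latticeMass (fun p => f p.swap) B = latticeMass f B :=
  (Equiv.prodComm ℤ ℤ).tsum_eq fun p : ℤ × ℤ => f (p.1 / B, p.2 / B)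

theorem latticeMass_shear (B : ℝ) :
    latticeMass (fun p => f (p.2, p.1 - p.2)) B = latticeMass f B := by
  let e : ℤ × ℤ ≃ ℤ × ℤ :=
    { toFun := fun p => (p.2, p.1 - p.2)
      invFun := fun p => (p.1 + p.2, p.1)
      left_inv := fun p => by ext <;> simp
      right_inv := fun p => by ext <;> simp }
  rw [latticeMass, latticeMass, ← e.tsum_eq fun p : ℤ × ℤ => f (p.1 / B, p.2 / B)]
  refine tsum_congr fun p => ?_
  simp [e, sub_div]

variable {ι : Type*} {l : Filter ι} [l.IsCountablyGenerated] {B : ι → ℝ}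

/-- The abscissa `s i` must be allowed to move: in the outer Riemann sum it is the lattice point `⌊B
i * x⌋ / B i`. -/
theorem tendsto_rowSum (hf : IsDensity f) (hB : Tendsto B l atTop) {x : ℝ} {s : ι → ℝ}
    (hs : Tendsto s l (𝓝 x)) :
    Tendsto (fun i => (B i)⁻¹ * ∑' j : ℤ, f (s i, j / B i)) l (𝓝 (density0 f x)) := by
  obtain ⟨K, hK⟩ := hf.exists_box
  obtain ⟨C, hC0, hC⟩ := hf.exists_bound
  refine tendsto_riemann hB (g := fun i j => f (s i, j / B i)) (D := C) (R := K)
    (.of_forall fun i k => ?_) (.of_forall fun i k h => (hK _ _ h).2) fun y => ?_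
  · rw [abs_of_nonneg (hf.nonneg _)]
    exact hC _
  · exact (hf.cont.tendsto (x, y)).comp (hs.prodMk_nhds (tendsto_floor_div hB y))

theorem rowSum_bound (hf : IsDensity f) :
    ∃ D, ∀ B : ℝ, 1 ≤ B → ∀ s : ℝ, |B⁻¹ * ∑' j : ℤ, f (s, j / B)| ≤ D := by
  obtain ⟨K, hK⟩ := hf.exists_box
  obtain ⟨C, hC0, hC⟩ := hf.exists_bound
  refine ⟨2 * (K + 1) * C, fun B hB s => abs_riemann_le hB K.cast_nonneg (fun k => ?_)
    fun k h => (hK _ _ h).2⟩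
  rw [abs_of_nonneg (hf.nonneg _)]
  exact hC _

theorem rowSum_eq_zero {K : ℕ} (hK : ∀ x y, f (x, y) ≠ 0 → |x| ≤ K ∧ |y| ≤ K) {B s : ℝ}
    (hs : ¬ |s| ≤ K) : ∑' j : ℤ, f (s, j / B) = 0 := by
  have : ∀ j : ℤ, f (s, j / B) = 0 := fun j => by
    by_contra h
    exact hs (hK _ _ h).1
  simp [this]

theorem tendsto_latticeMass (hf : IsDensity f) (hB : Tendsto B l atTop) :
    Tendsto (fun i => (B i)⁻¹ * ((B i)⁻¹ * latticeMass f (B i))) l (𝓝 1) := by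
  obtain ⟨K, hK⟩ := hf.exists_box
  obtain ⟨D, hD⟩ := hf.rowSum_bound
  have h := tendsto_riemann hB
    (g := fun i k => (B i)⁻¹ * ∑' j : ℤ, f (k / B i, j / B i)) (G := density0 f) (D := D) (R := K)
    (by
      filter_upwards [hB.eventually_ge_atTop 1] with i hi k using hD _ hi _)
    (.of_forall fun i k h => by
      by_contra h0
      exact h (by simp only [rowSum_eq_zero hK h0, mul_zero]))
    fun x => hf.tendsto_rowSum hB (tendsto_floor_div hB x)
  rw [hf.integral_density0] at h
  refine h.congr' ?_
  filter_upwards [hB.eventually_gt_atTop 0] with i hi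
  rw [tsum_mul_left, hf.latticeMass_eq hi]

theorem exists_negMulLog_bound (D : ℝ) : ∃ E, 0 ≤ E ∧ ∀ x, |x| ≤ D → |Real.negMulLog x| ≤ E := by
  obtain ⟨E, hE⟩ := (isCompact_Icc (a := -D) (b := D)).exists_bound_of_continuousOn
    Real.continuous_negMulLog.continuousOn
  exact ⟨max E 0, le_max_right _ _, fun x hx => (hE x (abs_le.mp hx)).trans (le_max_left _ _)⟩

theorem tendsto_rowEntropy (hf : IsDensity f) (hB : Tendsto B l atTop) :
    Tendsto (fun i => rowEntropy f (B i) - Real.log (B i)) l (𝓝 (diffEntropy (density0 f))) := by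
  obtain ⟨K, hK⟩ := hf.exists_box
  obtain ⟨D, hD⟩ := hf.rowSum_bound
  obtain ⟨E, -, hE⟩ := exists_negMulLog_bound (2 * D)
  have hm := hf.tendsto_latticeMass hB
  -- Division by a normalised mass above `1/2` at most doubles the row sums, hence the bound `2 *
  -- D`.
  have hm2 : ∀ᶠ i in l, 1 / 2 < (B i)⁻¹ * ((B i)⁻¹ * latticeMass f (B i)) :=
    hm.eventually_const_lt (by norm_num)
  have h := tendsto_riemann hB
    (g := fun i k => Real.negMulLog (((B i)⁻¹ * ∑' j : ℤ, f (k / B i, j / B i)) /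
      ((B i)⁻¹ * ((B i)⁻¹ * latticeMass f (B i)))))
    (G := fun x => Real.negMulLog (density0 f x)) (D := E) (R := K)
    (by
      filter_upwards [hB.eventually_ge_atTop 1, hm2] with i hi h2 k
      refine hE _ ?_
      rw [abs_div, abs_of_pos (a := (B i)⁻¹ * ((B i)⁻¹ * latticeMass f (B i))) (by linarith),
        div_le_iff₀ (by linarith)]
      have := hD _ hi (k / B i)
      nlinarith [abs_nonneg ((B i)⁻¹ * ∑' j : ℤ, f (k / B i, j / B i))])
    (.of_forall fun i k h => by
      by_contra h0
      exact h (by simp only [rowSum_eq_zero hK h0, mul_zero, zero_div, Real.negMulLog_zero]))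
    fun x => by
      refine (Real.continuous_negMulLog.tendsto _).comp ?_
      have := (hf.tendsto_rowSum hB (tendsto_floor_div hB x)).div hm one_ne_zero
      rwa [div_one] at this
  refine h.congr' ?_
  filter_upwards [hB.eventually_gt_atTop 0, hm2] with i hi h2
  have hT : latticeMass f (B i) ≠ 0 := by
    intro h0
    rw [h0] at h2
    norm_num at h2
  have hfin : (Function.support fun k : ℤ =>
      (∑' j : ℤ, f (k / B i, j / B i)) / latticeMass f (B i)).Finite :=
    finite_support_of_abs_le hi (R := K) fun k h => by
      by_contra h0
      exact h (by simp only [rowSum_eq_zero hK h0, zero_div])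
  rw [rowEntropy, tsum_negMulLog_rescale hfin (by rw [tsum_div_const, ← hf.latticeMass_eq hi,
    div_self hT]) hi, add_sub_cancel_left]
  congr 2
  funext k
  congr 1
  field_simp

/-- A lattice step by `(-a, b)` becomes `(-a/b, 1)` after scaling, which is exactly the folding
shift of slope `a/b`. -/
theorem folded_div_eq_fiberMass {a b : ℤ} (hb : 0 < b) (T : ℝ)
    (k : {p : ℤ × ℤ // p.2 ∈ Set.Ico 0 b}) :
    folded (a / b) f (k.1.1 / b) (k.1.2 / b) / T =
      fiberMass (fun p : ℤ × ℤ => f (p.1 / (b : ℝ), p.2 / (b : ℝ)) / T) (stripProj a b hb) k := by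
  have hb' : (b : ℝ) ≠ 0 := by exact_mod_cast hb.ne'
  rw [fiberMass_eq_tsum _ _ k (stripProj_fiber_injective hb _ _) (stripProj_fiber hb k), folded,
    tsum_div_const]
  congr 1
  refine tsum_congr fun j => ?_
  congr 2
  · push_cast; field_simp
  · push_cast; field_simp

theorem finite_support_weights (hf : IsDensity f) {B : ℝ} (hB : 0 < B) (T : ℝ) :
    (Function.support fun p : ℤ × ℤ => f (p.1 / B, p.2 / B) / T).Finite :=
  (hf.finite_support_samples hB).subset fun p hp h => hp (by simp only [h, zero_div])

/-- The rescaled entropy of the folded distribution as an iterated Riemann sum. -/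
theorem foldEntropy_eq (hf : IsDensity f) {a b : ℤ} (hb : 0 < b) (hT : latticeMass f b ≠ 0) :
    foldEntropy f a b = 2 * Real.log b + (b : ℝ)⁻¹ * ∑' j : ℤ, (Set.Ico 0 b).indicator
      (fun j => (b : ℝ)⁻¹ * ∑' k : ℤ, Real.negMulLog (folded (a / b) f (k / b) (j / b) /
        ((b : ℝ)⁻¹ * ((b : ℝ)⁻¹ * latticeMass f b)))) j := by
  have hB : (0 : ℝ) < b := by exact_mod_cast hb
  set T := latticeMass f b with hTdef
  set w : ℤ × ℤ → ℝ := fun p => f (p.1 / (b : ℝ), p.2 / (b : ℝ)) / T with hw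
  have hfin : (Function.support w).Finite := hf.finite_support_weights hB T
  have hsum : ∑' p, w p = 1 := by
    rw [hw, tsum_div_const]; exact div_self hT
  set m := fiberMass w (stripProj a b hb) with hm
  have hmfin : (Function.support m).Finite := (hfin.image _).subset (fiberMass_support _ _)
  have hm1 : ∑' k, m k = 1 := by rw [hm, tsum_fiberMass hfin, hsum]
  have h1 : foldEntropy f a b = ∑' k, Real.negMulLog (m k) :=
    tsum_congr fun k => by rw [folded_div_eq_fiberMass hb]
  -- A mesh cell has area `b⁻²`, so scaling by `b ^ 2` turns atoms into density values and yields `2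
  -- log b`.
  rw [h1, tsum_negMulLog_rescale hmfin hm1 (c := (b : ℝ) ^ 2) (by positivity), Real.log_pow,
    Nat.cast_ofNat]
  congr 1
  set g : ℤ × ℤ → ℝ := fun p => Real.negMulLog (folded (a / b) f (p.1 / b) (p.2 / b) /
        ((b : ℝ)⁻¹ * ((b : ℝ)⁻¹ * T))) with hg
  set S : Set (ℤ × ℤ) := {p | p.2 ∈ Set.Ico 0 b} with hS
  have hgm : ∀ k : S, Real.negMulLog ((b : ℝ) ^ 2 * m k) = g k := by
    intro k
    rw [hm, hw, ← folded_div_eq_fiberMass hb, hg]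
    congr 1
    field_simp
  have hsupp : (Function.support (S.indicator g)).Finite := by
    refine (hmfin.image Subtype.val).subset fun p hp => ?_
    rw [Set.support_indicator] at hp
    refine ⟨⟨p, hp.1⟩, fun h => hp.2 ?_, rfl⟩
    rw [← hgm ⟨p, hp.1⟩, h, mul_zero, Real.negMulLog_zero]
  have h2 : ∑' k, Real.negMulLog ((b : ℝ) ^ 2 * m k) = ∑' j : ℤ, ∑' k : ℤ, S.indicator g (k, j) := by
    calc ∑' k, Real.negMulLog ((b : ℝ) ^ 2 * m k) = ∑' k : S, g k := tsum_congr hgm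
      _ = ∑' p, S.indicator g p := tsum_subtype S g
      _ = ∑' p : ℤ × ℤ, S.indicator g p.swap := ((Equiv.prodComm ℤ ℤ).tsum_eq _).symm
      _ = _ := (summable_of_hasFiniteSupport
        (hsupp.preimage (Prod.swap_injective.injOn)) : Summable fun p : ℤ × ℤ =>
          S.indicator g p.swap).tsum_prod
  rw [h2, sq, mul_inv, mul_assoc, ← tsum_mul_left]
  congr 1
  refine tsum_congr fun j => ?_
  by_cases hj : j ∈ Set.Ico 0 b
  · rw [Set.indicator_of_mem hj]
    congr 1
    exact tsum_congr fun k => Set.indicator_of_mem (s := S) hj g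
  · rw [Set.indicator_of_notMem hj]
    have : ∀ k, S.indicator g (k, j) = 0 := fun k => Set.indicator_of_notMem (s := S) hj g
    simp [this]

theorem tendsto_foldEntropy (hf : IsDensity f) {a b : ι → ℤ} {α : ℝ}
    (hB : Tendsto (fun i => (b i : ℝ)) l atTop)
    (ht : Tendsto (fun i => (a i : ℝ) / b i) l (𝓝 α)) :
    Tendsto (fun i => foldEntropy f (a i) (b i) - 2 * Real.log (b i)) l
      (𝓝 (stripEntropy (folded α f))) := by
  obtain ⟨K, hK⟩ := hf.exists_box
  obtain ⟨C, hC0, hC⟩ := hf.exists_bound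
  set J := Finset.Icc (-(K : ℤ) - 1) (K : ℤ) with hJ
  set τ : ι → ℝ := fun i => (b i : ℝ)⁻¹ * ((b i : ℝ)⁻¹ * latticeMass f (b i)) with hτ
  have hm : Tendsto τ l (𝓝 1) := hf.tendsto_latticeMass hB
  have hm2 : ∀ᶠ i in l, 1 / 2 < τ i := hm.eventually_const_lt (by norm_num)
  obtain ⟨E, hE0, hE⟩ := exists_negMulLog_bound (2 * (J.card * C))
  set R : ℝ := K + (|α| + 1) * (K + 1) with hR
  have hR0 : 0 ≤ R := by positivity
  have htb : ∀ᶠ i in l, |(a i : ℝ) / b i| ≤ |α| + 1 :=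
    ht.abs.eventually_le_const (by linarith)
  have hb1 := hB.eventually_ge_atTop 1
  set F : ι → ℤ → ℤ → ℝ := fun i j k =>
    Real.negMulLog (folded (a i / b i) f (k / b i) (j / b i) / τ i) with hF
  have hy : ∀ i, 1 ≤ (b i : ℝ) → ∀ j ∈ Set.Ico 0 (b i), (j / b i : ℝ) ∈ Set.Ico (0 : ℝ) 1 := by
    intro i hi j hj
    have hj0 : (0 : ℝ) ≤ j := by exact_mod_cast hj.1
    have hj1 : (j : ℝ) < b i := by exact_mod_cast hj.2
    exact ⟨by positivity, by rw [div_lt_one (by linarith)]; exact hj1⟩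
  have bF : ∀ᶠ i in l, ∀ j ∈ Set.Ico 0 (b i), ∀ k, |F i j k| ≤ E := by
    filter_upwards [hb1, hm2] with i hi h2 j hj k
    refine hE _ ?_
    rw [folded_eq_sum hK _ _ (hy i hi j hj), abs_div, abs_of_pos (by linarith : 0 < τ i),
      div_le_iff₀ (by linarith), abs_of_nonneg (Finset.sum_nonneg fun _ _ => hf.nonneg _)]
    have h3 := Finset.sum_le_card_nsmul J
      (fun n : ℤ => f (k / b i - a i / b i * n, j / b i + n)) C fun n _ => hC _
    rw [nsmul_eq_mul] at h3
    nlinarith [mul_nonneg (Nat.cast_nonneg (α := ℝ) J.card) hC0]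
  have sF : ∀ᶠ i in l, ∀ j ∈ Set.Ico 0 (b i), ∀ k, F i j k ≠ 0 → |(k : ℝ) / b i| ≤ R := by
    filter_upwards [hb1, htb] with i hi h2 j hj k hne
    have h3 : folded (a i / b i) f (k / b i) (j / b i) ≠ 0 := fun h0 =>
      hne (by simp only [hF, h0, zero_div, Real.negMulLog_zero])
    rw [folded_eq_sum hK _ _ (hy i hi j hj)] at h3
    refine (foldSum_support hK h3).trans ?_
    rw [hR]
    gcongr
  have lim := tendsto_riemann hB
    (g := fun i => (Set.Ico 0 (b i)).indicator fun j => (b i : ℝ)⁻¹ * ∑' k : ℤ, F i j k)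
    (G := (Set.Ico (0 : ℝ) 1).indicator fun y => ∫ x, Real.negMulLog (folded α f x y))
    (D := 2 * (R + 1) * E) (R := 1)
    (by
      filter_upwards [hb1, bF, sF] with i hi h2 h3 j
      by_cases hj : j ∈ Set.Ico 0 (b i)
      · rw [Set.indicator_of_mem hj]
        exact abs_riemann_le hi hR0 (h2 j hj) (h3 j hj)
      · rw [Set.indicator_of_notMem hj, abs_zero]
        positivity)
    (by
      filter_upwards [hb1] with i hi j hne
      have := hy i hi j (Set.mem_of_indicator_ne_zero hne)
      rw [abs_of_nonneg this.1]
      exact this.2.le)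
    fun y => by
      by_cases hy1 : y ∈ Set.Ico (0 : ℝ) 1
      · rw [Set.indicator_of_mem hy1]
        have hmem : ∀ᶠ i in l, ⌊(b i : ℝ) * y⌋ ∈ Set.Ico 0 (b i) := by
          filter_upwards [hb1] with i hi
          refine ⟨Int.floor_nonneg.mpr (mul_nonneg (by linarith) hy1.1), Int.floor_lt.mpr ?_⟩
          nlinarith [hy1.2]
        have inner := tendsto_riemann hB (g := fun i k => F i ⌊(b i : ℝ) * y⌋ k)
          (G := fun x => Real.negMulLog (folded α f x y)) (D := E) (R := R)
          (by filter_upwards [bF, hmem] with i h1 h2 using h1 _ h2)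
          (by filter_upwards [sF, hmem] with i h1 h2 using h1 _ h2)
          fun x => by
            refine (Real.continuous_negMulLog.tendsto _).comp ?_
            -- The slope `a i / b i` moves along with the sample point, so joint continuity is
            -- needed.
            have hc := ((hf.continuous_foldSum J).tendsto (α, x, y)).comp
              (ht.prodMk_nhds ((tendsto_floor_div hB x).prodMk_nhds (tendsto_floor_div hB y)))
            have hd := hc.div hm one_ne_zero
            rw [div_one] at hd
            rw [folded_eq_sum hK α x hy1]
            refine hd.congr' ?_
            filter_upwards [hb1, hmem] with i hi h2
            simp only [Function.comp_apply, Pi.div_apply]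
            rw [folded_eq_sum hK _ _ (hy i hi _ h2)]
        refine inner.congr' ?_
        filter_upwards [hmem] with i h2
        rw [Set.indicator_of_mem h2]
      · rw [Set.indicator_of_notMem hy1]
        refine tendsto_const_nhds.congr' ?_
        filter_upwards [hb1] with i hi
        refine (Set.indicator_of_notMem (fun h => hy1 ?_) _).symm
        have h0 : 0 ≤ (b i : ℝ) * y := Int.floor_nonneg.mp h.1
        have h1 : (b i : ℝ) * y < b i := Int.floor_lt.mp h.2
        exact ⟨by nlinarith, by nlinarith⟩
  rw [integral_indicator measurableSet_Ico] at lim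
  refine lim.congr' ?_
  filter_upwards [hb1, hm2] with i hi h2
  have hT : latticeMass f (b i) ≠ 0 := by
    intro h0
    simp only [hτ, h0] at h2
    norm_num at h2
  rw [hf.foldEntropy_eq (by exact_mod_cast (by linarith : (0 : ℝ) < b i)) hT, add_sub_cancel_left]

end IsDensity

/-! ### From sampled densities to admissible exponents -/

theorem fiberMass_sample_eq_rowSum {F : ℝ × ℝ → ℝ} {B T : ℝ} (k : ℤ) :
    fiberMass (fun p : ℤ × ℤ => F (p.1 / B, p.2 / B) / T) Prod.fst k =
      (∑' j : ℤ, F (k / B, j / B)) / T := by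
  rw [fiberMass_eq_tsum _ _ k (φ := fun j : ℤ => (k, j)) (Prod.mk_right_injective k) ?_,
    tsum_div_const]
  ext ⟨x, y⟩
  simp [eq_comm]

theorem entropy_nonneg {Ω : Type} [MeasurableSpace Ω] (μ : Measure Ω) [IsProbabilityMeasure μ]
    (Z : Ω → ℚ) : 0 ≤ entropy μ Z :=
  tsum_nonneg fun _ => Real.negMulLog_nonneg measureReal_nonneg measureReal_le_one

namespace IsDensity

variable {f : ℝ × ℝ → ℝ}

variable {ι : Type*} {l : Filter ι} [l.IsCountablyGenerated]

/-- An admissible exponent bounds the folded entropy by the row entropies. -/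
theorem foldEntropy_le (hf : IsDensity f) {a b : ℤ} (hab : IsCoprime a b) (hb : 0 < b)
    (hT : 0 < latticeMass f b) {C M : ℝ}
    (hC : IsExponent threeSlopes (((a : ℚ) / (b : ℚ) : ℚ) : Slope) C)
    (h0 : rowEntropy f b ≤ M) (hinf : rowEntropy (fun p => f p.swap) b ≤ M)
    (h1 : rowEntropy (fun p => f (p.2, p.1 - p.2)) b ≤ M) :
    ∃ V, 0 ≤ V ∧ V ≤ M ∧ foldEntropy f a b ≤ C * V := by
  have hB : (0 : ℝ) < b := by exact_mod_cast hb
  set w : ℤ × ℤ → ℝ := fun p => f (p.1 / (b : ℝ), p.2 / (b : ℝ)) / latticeMass f b with hw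
  have hsum : ∑' p, w p = 1 := by
    rw [hw, tsum_div_const]; exact div_self hT.ne'
  obtain ⟨Ω, _, μ, _, X, Y, hX, hY, hXf, hYf, hZ⟩ := exists_random_variables
    (fun p => div_nonneg (hf.nonneg _) hT.le) (hf.finite_support_weights hB _) hsum
  have hent : ∀ r : Slope, entropy μ (fun u => proj r (X u) (Y u)) =
      ∑' q, Real.negMulLog (fiberMass w (fun p => proj r p.1 p.2) q) := fun r =>
    tsum_congr fun q => by rw [hZ (proj r) q]
  have hcast : Function.Injective (Int.cast : ℤ → ℚ) := Int.cast_injective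
  have e0 : entropy μ (fun u => proj ((0 : ℚ) : Slope) (X u) (Y u)) = rowEntropy f b := by
    have hp : (fun p : ℤ × ℤ => proj ((0 : ℚ) : Slope) p.1 p.2) =
        fun p => ((Prod.fst p : ℤ) : ℚ) := by funext p; simp [proj_coe]
    rw [hent, hp, tsum_negMulLog_fiberMass w Prod.fst hcast]
    exact tsum_congr fun k => by rw [hw, fiberMass_sample_eq_rowSum]
  have einf : entropy μ (fun u => proj OnePoint.infty (X u) (Y u)) =
      rowEntropy (fun p => f p.swap) b := by
    have hp : (fun p : ℤ × ℤ => proj OnePoint.infty p.1 p.2) =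
        fun p => ((Prod.snd p : ℤ) : ℚ) := by funext p; simp [proj_infty]
    rw [hent, hp, tsum_negMulLog_fiberMass w Prod.snd hcast]
    refine tsum_congr fun k => ?_
    rw [fiberMass_eq_tsum w _ k (φ := fun j : ℤ => (j, k)) (Prod.mk_left_injective k)
      (by ext ⟨x, y⟩; simp [eq_comm]), hw, tsum_div_const, latticeMass_swap]
    rfl
  have e1 : entropy μ (fun u => proj ((1 : ℚ) : Slope) (X u) (Y u)) =
      rowEntropy (fun p => f (p.2, p.1 - p.2)) b := by
    have hp : (fun p : ℤ × ℤ => proj ((1 : ℚ) : Slope) p.1 p.2) =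
        fun p => (((fun p : ℤ × ℤ => p.1 + p.2) p : ℤ) : ℚ) := by funext p; simp [proj_coe]
    rw [hent, hp, tsum_negMulLog_fiberMass w (fun p : ℤ × ℤ => p.1 + p.2) hcast]
    refine tsum_congr fun k => ?_
    rw [fiberMass_eq_tsum w _ k (φ := fun j : ℤ => (j, k - j))
      (fun i j h => (Prod.mk.inj h).1) (by
        ext ⟨x, y⟩
        simp only [Set.mem_range, Prod.mk.injEq, Set.mem_preimage, Set.mem_singleton_iff]
        exact ⟨by rintro ⟨j, rfl, rfl⟩; ring, fun h => ⟨x, rfl, by linarith⟩⟩),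
      hw, tsum_div_const, latticeMass_shear]
    simp [sub_div]
  have es : entropy μ (fun u => proj (((a : ℚ) / (b : ℚ) : ℚ) : Slope) (X u) (Y u)) =
      foldEntropy f a b := by
    have hp : (fun p : ℤ × ℤ => proj (((a : ℚ) / (b : ℚ) : ℚ) : Slope) p.1 p.2) =
        fun p => ((stripProj a b hb p).1.1 : ℚ) +
          (a / b : ℚ) * ((stripProj a b hb p).1.2 : ℚ) := by
      funext p; rw [proj_coe, strip_value hb p]
    rw [hent, hp, tsum_negMulLog_fiberMass w (stripProj a b hb) (strip_value_injective hb hab)]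
    exact tsum_congr fun k => by rw [hw, folded_div_eq_fiberMass hb]
  -- `V` is the maximal projected entropy itself. It cannot yet be replaced by `M`, since the sign
  -- of `C` is not known.
  refine ⟨_, ?_, ?_, es ▸ hC Ω μ X Y hX hY hXf hYf⟩
  · exact Real.iSup_nonneg fun r => entropy_nonneg μ _
  · have : Nonempty threeSlopes := ⟨⟨OnePoint.infty, by simp [threeSlopes]⟩⟩
    refine ciSup_le fun r => ?_
    obtain ⟨r, hr⟩ := r
    simp only [threeSlopes, Finset.mem_insert, Finset.mem_singleton] at hr
    rcases hr with rfl | rfl | rfl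
    · rwa [e0]
    · rwa [e1]
    · rwa [einf]

/-- Every density gives an asymptotic lower bound for admissible exponents. -/
theorem eventually_le_exponent (hf : IsDensity f) {a b : ι → ℤ} {α c : ℝ}
    (hB : Tendsto (fun i => (b i : ℝ)) l atTop)
    (ht : Tendsto (fun i => (a i : ℝ) / b i) l (𝓝 α)) (hc : functional α f < c) :
    ∀ᶠ i in l, IsCoprime (a i) (b i) → ∀ C,
      IsExponent threeSlopes (((a i : ℚ) / (b i : ℚ) : ℚ) : Slope) C →
        2 - c / Real.log (b i) ≤ C := by
  set M := max (diffEntropy (density0 f))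
        (max (diffEntropy (densityInf f)) (diffEntropy (density1 f))) with hM
  set h2 := stripEntropy (folded α f) with hh2
  have hF : functional α f = 2 * M - h2 := rfl
  -- The errors cost `4η` in total: `2η` from the three rows, `η` from the folding and `η` from the
  -- term of order `1 / log b`. The available gap is `6η`.
  set η := (c - functional α f) / 6 with hη
  have hη0 : 0 < η := by rw [hη]; linarith
  have r0 := (hf.tendsto_rowEntropy hB).eventually_lt_const
    (show diffEntropy (density0 f) < M + η from
      (le_max_left _ _).trans_lt (lt_add_of_pos_right _ hη0))
  have rinf := (hf.swap.tendsto_rowEntropy hB).eventually_lt_const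
    (show diffEntropy (density0 fun p => f p.swap) < M + η from
      ((le_max_left _ _).trans (le_max_right _ _)).trans_lt (lt_add_of_pos_right _ hη0))
  have r1 := (hf.shear.tendsto_rowEntropy hB).eventually_lt_const
    (show diffEntropy (density0 fun p => f (p.2, p.1 - p.2)) < M + η from
      ((le_max_right _ _).trans (le_max_right _ _)).trans_lt (lt_add_of_pos_right _ hη0))
  have rs := (hf.tendsto_foldEntropy hB ht).eventually_const_lt (show h2 - η < h2 by linarith)
  have hm := (hf.tendsto_latticeMass hB).eventually_const_lt (show (0 : ℝ) < 1 by norm_num)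
  have hlog := Real.tendsto_log_atTop.comp hB
  -- `log b > c / 2` makes `2 - c / log b` nonnegative, so that `V` may be replaced by its upper
  -- bound.
  have q0 := hlog.eventually_gt_atTop (max 0 (c / 2))
  have q1 : ∀ᶠ i in l, -(c * (M + η) / Real.log (b i)) < η := by
    have := (hlog.const_div_atTop (c * (M + η))).neg
    rw [neg_zero] at this
    exact this.eventually_lt_const hη0
  filter_upwards [r0, rinf, r1, rs, hm, q0, q1, hB.eventually_gt_atTop 0]
    with i r0 rinf r1 rs hm q0 q1 hb hab C hC
  set L := Real.log (b i) with hL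
  have hLdef : (Real.log ∘ fun i => (b i : ℝ)) i = L := rfl
  rw [hLdef] at q0
  have hL0 : 0 < L := (le_max_left _ _).trans_lt q0
  have hLc : c / 2 < L := (le_max_right _ _).trans_lt q0
  have hbi : 0 < b i := by exact_mod_cast hb
  have hT : 0 < latticeMass f (b i) := by
    have := inv_pos.mpr hb
    exact (pos_iff_pos_of_mul_pos (a := ((b i : ℝ))⁻¹)
      ((pos_iff_pos_of_mul_pos hm).mp this)).mp this
  obtain ⟨V, hV0, hVM, hV⟩ := hf.foldEntropy_le hab hbi hT hC (M := L + M + η)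
    (by linarith) (by linarith) (by linarith)
  by_contra! hlt
  have hD : 0 ≤ 2 - c / L := by
    have : c / L ≤ 2 := by rw [div_le_iff₀ hL0]; linarith
    linarith
  have h3 : C * V ≤ (2 - c / L) * (L + M + η) :=
    (mul_le_mul_of_nonneg_right hlt.le hV0).trans (mul_le_mul_of_nonneg_left hVM hD)
  have h4 : (2 - c / L) * (L + M + η) = 2 * L + 2 * M + 2 * η - c - c * (M + η) / L := by
    field_simp
    ring
  have h5 : c - (2 * M - h2) = 6 * η := by rw [hη, hF]; ring
  linarith

end IsDensity

end SumDifference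

end

/-! ### The infimum and the asymptotic bound -/

theorem mainTheorem3 (α : ℝ) :
    ∃ c : ℝ, 0 < c ∧
      IsGLB {v : ℝ | ∃ f : ℝ × ℝ → ℝ,
        SumDifference.IsTestDensity f ∧ v = SumDifference.functional α f} c ∧
      ∀ ε : ℝ, 0 < ε → ∃ δ : ℝ, 0 < δ ∧ ∃ N : ℕ, ∀ a b : ℤ, IsCoprime a b →
        (N : ℤ) ≤ b → |(a : ℝ) / (b : ℝ) - α| < δ →
          ((2 - (c + ε) / Real.log (b : ℝ) : ℝ) : EReal) ≤
            SumDifference.SD SumDifference.threeSlopes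
              (((a : ℚ) / (b : ℚ) : ℚ) : SumDifference.Slope) := by
  open Filter Topology SumDifference in
  set S : Set ℝ := {v : ℝ | ∃ f : ℝ × ℝ → ℝ, IsTestDensity f ∧ v = functional α f} with hS
  have hlow : ∀ v ∈ S, 1 / 20 ≤ v := by
    rintro v ⟨f, hf, rfl⟩
    exact hf.isDensity.le_functional α
  have hne : S.Nonempty := by
    obtain ⟨f, hf⟩ := exists_isTestDensity
    exact ⟨_, f, hf, rfl⟩
  have hglb : IsGLB S (sInf S) := isGLB_csInf hne ⟨_, hlow⟩
  refine ⟨sInf S, lt_of_lt_of_le (by norm_num) (le_csInf hne hlow), hglb, fun ε hε => ?_⟩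
  obtain ⟨_, ⟨f, hf, rfl⟩, hlt⟩ := exists_lt_of_csInf_lt hne (lt_add_of_pos_right (sInf S) hε)
  -- This filter encodes `a/b → α` and `b → +∞`; its basis of balls and half-lines provides `δ` and
  -- `N`.
  let l : Filter (ℤ × ℤ) :=
    comap (fun p => (p.1 : ℝ) / p.2) (𝓝 α) ⊓ comap (fun p => p.2) atTop
  have hev := hf.isDensity.eventually_le_exponent (l := l) (a := Prod.fst) (b := Prod.snd)
    (tendsto_intCast_atTop_atTop.comp (tendsto_comap.mono_left inf_le_right))
    (tendsto_comap.mono_left inf_le_left) hlt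
  obtain ⟨⟨δ, n⟩, ⟨hδ, -⟩, hsub⟩ := (((Metric.nhds_basis_ball (x := α)).comap _).inf
    ((atTop_basis (α := ℤ)).comap _)).eventually_iff.mp hev
  refine ⟨δ, hδ, n.toNat, fun a b hab hb hd => le_sInf ?_⟩
  rintro _ ⟨C, hC, rfl⟩
  exact EReal.coe_le_coe_iff.mpr
    (hsub (x := (a, b)) ⟨hd, (Int.self_le_toNat n).trans hb⟩ hab C hC)
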